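/- **Setting.** Let $n\ge 0$. Let $\mathcal{PT}$ be the span of the planar rooted trees with vertices decorated by $\{0,\dots,n\}$ and $\mathcal{OF}$ the span of the ordered forests (words) of such trees, $1$ being the empty forest. Write $B_+^c(\omega)$ for the tree whose root is decorated by $c$ and whose branches are the trees of $\omega$, in order, and $\bullet_c=B_+^c(1)$. Let $\shuffle$ be the shuffle product of words of trees. The Munthe-Kaas--Wright coproduct is $\Delta_{MKW}(\omega)=\sum_c P^c\otimes B_-(T^c)$, over the left admissible cuts $c$ of $B_+(\omega)$: at most one edge of $c$ lies on any path from the root to a leaf, and together with an edge $c$ contains all edges to its left at the same vertex. Here $T^c$ is the trunk, $B_-$ removes the root, and $P^c$ is the shuffle product of the forests cut off from the vertices of $T^c$. Linear forms on $\mathcal{OF}$ have the convolution $f\ast g=(f\otimes g)\Delta_{MKW}$. Let $\mathcal{PB}$ be the span of the planar rooted trees with edges decorated by $\{0,\dots,n\}$ ($0$ meaning undecorated) in which each edge with non-zero decoration ends in a leaf and is the rightmost edge at its lower vertex. Let $\varphi:\mathcal{PT}\to\mathcal{PB}$ be the isomorphism that replaces each vertex decorated by $i\neq 0$ by two vertices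 joined by a rightmost edge decorated by $i$; extend $\varphi$ to forests treewise, and let $B_+$ graft the trees of a forest, in order, by undecorated edges on a new root. Let $\mathcal{PB}_+$ be the span of the trees $B_+(\varphi(\omega))$ (those with no decorated edge at the root), with the product that joins the roots and shuffles the branches, and unit the one-vertex tree $\bullet$. Let $\alpha_1,\dots,\alpha_n>0$; the degree of a tree in $\mathcal{PB}$ is the sum over its edges of $1$ for an undecorated edge and $\alpha_i-1$ for an edge decorated by $i$. Let $S(\mathcal{PB}_-)$ be the free commutative algebra generated by the trees of negative degree. *Recentring.* $\Delta^+:\mathcal{PB}\to\mathcal{PB}_+\otimes\mathcal{PB}$ is defined by $\Delta^+(B_+\varphi(\omega))=(B_+\varphi\otimes B_+\varphi)\Delta_{MKW}(\omega)$, and by $\Delta^+(\tau)=(\mathrm{id}\otimes B_-)(\Delta^+(B_+\tau)-B_+\tau\otimes\bullet)$ if $\tau$ has a decorated edge at the root. For a linear form $g$ on $\mathcal{PB}_+$ put $\Gamma_g=(g\otimes\mathrm{id})\Delta^+$, and let $\mathcal{G}=\{\Gamma_g: g\text{ a character of }\mathcal{PB}_+\}$. *Renormalisation.* For a tree $\tau\in\mathcal{PT}$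 let $\rho_0(\tau)=\sum \tau_1\cdots\tau_k\otimes\tau/\tau_1\cdots\tau_k$ be the time-cotranslation with values in $S(\mathcal{PT})\otimes\mathcal{PT}$: the sum is over all sets of disjoint (not necessarily spanning, possibly no) subtrees such that whenever an edge belongs to $\tau_i$, so do all edges to its right at the same vertex; $\tau/\tau_1\cdots\tau_k$ is obtained by contracting each $\tau_i$ to a vertex decorated by $0$, the forests of remaining branches at the different vertices of $\tau_i$ being shuffled. Let $\pi^-$ be the algebra morphism that keeps the trees $\sigma$ with $\varphi(\sigma)$ of negative degree and kills all others, and let $\Delta^-=(\varphi\otimes\varphi)(\pi^-\otimes\mathrm{id})\rho_0\varphi^{-1}:\mathcal{PB}\to S(\mathcal{PB}_-)\otimes\mathcal{PB}$. For a character $\ell$ of $S(\mathcal{PB}_-)$ let $M_\ell=(\ell\otimes\mathrm{id})\Delta^-$. *The rough path and its model.* Let $\gamma\in(0,1]$ and let $(\mathbb{X}_{st})_{s,t\in\mathbb{R}}$ be linear forms on $\mathcal{OF}$ such that for all $s,t,u$: $\langle\mathbb{X}_{st},1\rangle=1$; $\langle\mathbb{X}_{st},x\shuffle y\rangle=\langle\mathbb{X}_{st},x\rangle\langle\mathbb{X}_{st},y\rangle$;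 $\mathbb{X}_{su}\ast\mathbb{X}_{ut}=\mathbb{X}_{st}$; and for every forest $\omega$ with $|\omega|$ vertices there are $C,N$ with $|\langle\mathbb{X}_{st},\omega\rangle|\le C(1+|s|+|t|)^N|t-s|^{\gamma|\omega|}$ for all $s\ne t$. Suppose also that $\langle\mathbb{X}_{st},\bullet_0\rangle=t-s$ and $\langle\mathbb{X}_{st},B_+^0(\omega)\rangle=\int_s^t\langle\mathbb{X}_{su},\omega\rangle\,du$ for all forests $\omega$. Define $\Pi_s:\mathcal{PB}\to\mathcal{S}'(\mathbb{R})$ by $\Pi_s(B_+\varphi(\omega))(t)=\langle\mathbb{X}_{st},\omega\rangle$ and by the distributional derivative $\Pi_s(\tau)=\frac{d}{dt}\Pi_s(B_+\tau)$ if $\tau$ has a decorated edge at the root, and let $\gamma_{st}$ be the character $B_+\varphi(\omega)\mapsto\langle\mathbb{X}_{st},\omega\rangle$ of $\mathcal{PB}_+$. **Proposition.** For every character $\ell$ of $S(\mathcal{PB}_-)$, $M_\ell$ maps $\mathcal{PB}_+$ into itself, and the renormalised pair $$\Pi_s^{M_\ell}=\Pi_sM_\ell,\qquad \Gamma_{st}^{M_\ell}=(\gamma_{ts}M_\ell\otimes\mathrm{id})\Delta^+$$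 is a model: for all $x,y,z\in\mathbb{R}$, $\Gamma^{M_\ell}_{xy}\in\mathcal{G}$, $\Gamma^{M_\ell}_{xx}=\mathrm{id}$, $\Gamma^{M_\ell}_{xy}\Gamma^{M_\ell}_{yz}=\Gamma^{M_\ell}_{xz}$; $\Pi^{M_\ell}_x$ is a linear map from $\mathcal{PB}$ to $\mathcal{S}'(\mathbb{R})$, continuous on each homogeneous component of $\mathcal{PB}$; and $\Pi^{M_\ell}_x\Gamma^{M_\ell}_{xy}=\Pi^{M_\ell}_y$. -/

import Mathlib

open scoped TensorProduct SchwartzMap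

namespace PlanarRP

variable {n : ℕ}

/-! ## Planar rooted trees with decorated vertices, ordered forests -/

/-- Planar rooted trees with vertices decorated by `{0, …, n}`: a single vertex, or the tree
`graft σ τ` obtained from `τ` by adding a new leftmost edge from the root of `τ` to the root
of `σ`. -/
inductive PT (n : ℕ) : Type
  | vertex (c : Fin (n + 1)) : PT n
  | graft (σ τ : PT n) : PT n

namespace PT

/-- The decoration of the root. -/
def root : PT n → Fin (n + 1)
  | vertex c => c
  | graft _ τ => root τ

/-- The ordered forest of branches at the root, from left to right (the map `B₋`). -/
def branches : PT n → List (PT n)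
  | vertex _ => []
  | graft σ τ => σ :: branches τ

/-- The tree whose root is decorated by `c` and whose branches are the trees of `ω`, in order. -/
def bPlus (c : Fin (n + 1)) (ω : List (PT n)) : PT n := ω.foldr graft (vertex c)

/-- The number of vertices. -/
def size : PT n → ℕ
  | vertex _ => 1
  | graft σ τ => size σ + size τ

theorem bPlus_root_branches (τ : PT n) : bPlus τ.root τ.branches = τ := by
  induction τ with
  | vertex c => rfl
  | graft σ τ _ ih => simpa [bPlus, root, branches] using ih

theorem root_bPlus (c : Fin (n + 1)) (ω : List (PT n)) : (bPlus c ω).root = c := by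
  induction ω with
  | nil => rfl
  | cons σ ω ih => simpa [bPlus, root] using ih

theorem branches_bPlus (c : Fin (n + 1)) (ω : List (PT n)) : (bPlus c ω).branches = ω := by
  induction ω with
  | nil => rfl
  | cons σ ω ih => simpa [bPlus, branches] using ih

end PT

/-! ## Shuffles -/

/-- All shuffles of two words, listed with multiplicity. -/
def shuffles {A : Type*} : List A → List A → List (List A)
  | [], w => [w]
  | a :: v, [] => [a :: v]
  | a :: v, b :: w =>
      ((shuffles v (b :: w)).map (a :: ·)) ++ ((shuffles (a :: v) w).map (b :: ·))
termination_by v w => v.length + w.length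

/-- All shuffles of a finite family of words, listed with multiplicity. -/
def shuffleAll {A : Type*} : List (List A) → List (List A)
  | [] => [[]]
  | w :: ws => (shuffleAll ws).flatMap (shuffles w)

/-! ## The Munthe-Kaas--Wright Hopf algebra -/

/-- The space of ordered forests, with basis the words in planar trees. -/
abbrev OF (n : ℕ) : Type := List (PT n) →₀ ℝ

/-- The shuffle product on ordered forests. -/
noncomputable def shuffle : OF n →ₗ[ℝ] OF n →ₗ[ℝ] OF n :=
  Finsupp.lift _ ℝ _ fun v => Finsupp.lift _ ℝ _ fun w =>
    ((shuffles v w).map fun u => Finsupp.single u (1 : ℝ)).sum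

/-- The outcome of a left admissible cut of a tree: the forest cut off from the root, the list of
the forests cut off from the other vertices of the trunk, and the trunk. -/
structure LeftCut (n : ℕ) where
  atRoot : List (PT n)
  above : List (List (PT n))
  trunk : PT n

/-- All left admissible cuts of a tree. In `graft σ τ`, either the new leftmost edge is cut, or it
is kept, and then no edge at the root may be cut. -/
def leftCuts : PT n → List (LeftCut n)
  | .vertex c => [⟨[], [], .vertex c⟩]
  | .graft σ τ =>
      ((leftCuts τ).map fun k => ⟨σ :: k.atRoot, k.above, k.trunk⟩) ++
      (leftCuts σ).flatMap fun k =>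
        ((leftCuts τ).filter fun l => l.atRoot.isEmpty).map fun l =>
          ⟨[], k.atRoot :: (k.above ++ l.above), .graft k.trunk l.trunk⟩

/-- The Munthe-Kaas--Wright coproduct: the sum over all left admissible cuts of `B₊ ω` of the
shuffle of the pruned forests, tensor the trunk without its root. -/
noncomputable def mkw : OF n →ₗ[ℝ] OF n ⊗[ℝ] OF n :=
  Finsupp.lift _ ℝ _ fun ω =>
    ((leftCuts (PT.bPlus 0 ω)).map fun k =>
      ((shuffleAll (k.atRoot :: k.above)).map fun u =>
        (Finsupp.single u (1 : ℝ)) ⊗ₜ[ℝ] (Finsupp.single k.trunk.branches (1 : ℝ))).sum).sum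

/-- The convolution product of linear forms dual to the Munthe-Kaas--Wright coproduct. -/
noncomputable def conv (f g : OF n →ₗ[ℝ] ℝ) : OF n →ₗ[ℝ] ℝ :=
  (TensorProduct.lid ℝ ℝ).toLinearMap ∘ₗ TensorProduct.map f g ∘ₗ mkw

/-- The number of vertices of a forest. -/
def forestSize (ω : List (PT n)) : ℕ := (ω.map PT.size).sum

/-- `γ`-regular planarly branched rough paths on the real line. In the Hölder estimate the constant
may grow polynomially in `s` and `t`. -/
structure IsRoughPath (γ : ℝ) (X : ℝ → ℝ → OF n →ₗ[ℝ] ℝ) : Prop where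
  unit : ∀ s t, X s t (Finsupp.single [] 1) = 1
  mul : ∀ s t x y, X s t (shuffle x y) = X s t x * X s t y
  chen : ∀ s t u, conv (X s u) (X u t) = X s t
  holder : ∀ ω : List (PT n), ∃ (C : ℝ) (N : ℕ), ∀ s t : ℝ, s ≠ t →
    |X s t (Finsupp.single ω 1)| ≤
      C * (1 + |s| + |t|) ^ N * |t - s| ^ (γ * (forestSize ω : ℝ))

/-! ## The trees with decorated edges, and the isomorphism `φ` -/

/-- Planar rooted trees with edges decorated by `{0, …, n}` (decoration `0` is `undecorated`): a
single vertex, or the tree obtained from `τ` by adding to its root a new leftmost edge, decorated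
by `d`, which leads to the root of `σ`. -/
inductive ETree (n : ℕ) : Type
  | point : ETree n
  | branch (d : Fin (n + 1)) (σ τ : ETree n) : ETree n

/-- The trees in which every edge with a non-zero decoration leads to a leaf and is the rightmost
edge at its lower vertex (so that there is at most one such edge at each vertex). -/
def ETree.IsPB : ETree n → Prop
  | .point => True
  | .branch d σ τ => if d = 0 then σ.IsPB ∧ τ.IsPB else σ = .point ∧ τ = .point

/-- No edge with a non-zero decoration is adjacent to the root. -/
def ETree.NoNoiseAtRoot : ETree n → Prop
  | .point => True
  | .branch d _ τ => d = 0 ∧ τ.NoNoiseAtRoot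

/-- The degree: an undecorated edge contributes `1`, an edge decorated by `i` contributes
`α i - 1`. -/
noncomputable def ETree.degree (α : Fin n → ℝ) : ETree n → ℝ
  | .point => 0
  | .branch d σ τ =>
      Fin.cases (motive := fun _ => ℝ) 1 (fun i => α i - 1) d + σ.degree α + τ.degree α

/-- The basis of the model space. -/
abbrev PB (n : ℕ) : Type := {τ : ETree n // τ.IsPB}

/-- The map `φ`: each vertex with a non-zero decoration is replaced by two vertices that are
connected by a rightmost edge of the same decoration. -/
def phiFun : PT n → ETree n
  | .vertex c => if c = 0 then .point else .branch c .point .point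
  | .graft σ τ => .branch 0 (phiFun σ) (phiFun τ)

/-- The inverse of `φ`. -/
def phiInv : ETree n → PT n
  | .point => .vertex 0
  | .branch d σ τ => if d = 0 then .graft (phiInv σ) (phiInv τ) else .vertex d

theorem phiFun_isPB (τ : PT n) : (phiFun τ).IsPB := by
  induction τ with
  | vertex c =>
    by_cases h : c = 0
    · simp [phiFun, h, ETree.IsPB]
    · simp [phiFun, h, ETree.IsPB]
  | graft σ τ ihσ ihτ => simp [phiFun, ETree.IsPB, ihσ, ihτ]

theorem phiInv_phiFun (τ : PT n) : phiInv (phiFun τ) = τ := by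
  induction τ with
  | vertex c =>
    by_cases h : c = 0
    · simp [phiFun, h, phiInv]
    · simp [phiFun, h, phiInv]
  | graft σ τ ihσ ihτ => simp [phiFun, phiInv, ihσ, ihτ]

theorem phiFun_phiInv (τ : ETree n) (hτ : τ.IsPB) : phiFun (phiInv τ) = τ := by
  induction τ with
  | point => simp [phiFun, phiInv]
  | branch d σ τ ihσ ihτ =>
    by_cases h : d = 0
    · simp only [ETree.IsPB, h, if_true] at hτ
      simp [phiFun, phiInv, h, ihσ hτ.1, ihτ hτ.2]
    · simp only [ETree.IsPB, h, if_false] at hτ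
      simp [phiFun, phiInv, h, hτ.1, hτ.2]

/-- The isomorphism `φ`, on basis trees. -/
def phi : PT n ≃ PB n where
  toFun τ := ⟨phiFun τ, phiFun_isPB τ⟩
  invFun τ := phiInv τ.1
  left_inv τ := phiInv_phiFun τ
  right_inv τ := Subtype.ext (phiFun_phiInv τ.1 τ.2)

/-- The degree of a basis tree of the model space. -/
noncomputable def deg (α : Fin n → ℝ) (τ : PB n) : ℝ := τ.1.degree α

/-- The single vertex. -/
def pointPB : PB n := ⟨.point, trivial⟩

/-- The map `B₊` on forests of edge-decorated trees: graft all trees, in order, on a new root by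
undecorated edges. -/
def bPlusE : List (PB n) → PB n
  | [] => pointPB
  | σ :: ω => ⟨.branch 0 σ.1 (bPlusE ω).1, by
      simpa [ETree.IsPB] using ⟨σ.2, (bPlusE ω).2⟩⟩

/-- The basis of `PB₊`: the trees without decorated edge at the root. When all `α i > 0`, they are
all of positive degree, except for the single vertex, which is the unit. -/
abbrev PBPlus (n : ℕ) : Type := {τ : PB n // τ.1.NoNoiseAtRoot}

theorem degree_pos_of_noNoise (α : Fin n → ℝ) (hα : ∀ i, 0 < α i) (τ : ETree n) (hτ : τ.IsPB) :
    -1 < τ.degree α ∧ (τ.NoNoiseAtRoot → τ = .point ∨ 0 < τ.degree α) := by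
  induction τ with
  | point => exact ⟨by norm_num [ETree.degree], fun _ => Or.inl rfl⟩
  | branch d σ τ ihσ ihτ =>
    by_cases h : d = 0
    · subst h
      simp only [ETree.IsPB, if_true] at hτ
      have h1 := (ihσ hτ.1).1
      have h2 := ihτ hτ.2
      refine ⟨?_, fun hn => Or.inr ?_⟩
      · simp only [ETree.degree, Fin.cases_zero]
        linarith [h2.1]
      · simp only [ETree.degree, Fin.cases_zero]
        rcases h2.2 hn.2 with h3 | h3
        · subst h3
          simp only [ETree.degree]
          linarith
        · linarith
    · simp only [ETree.IsPB, h, if_false] at hτ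
      obtain ⟨i, rfl⟩ := Fin.exists_succ_eq.mpr h
      refine ⟨?_, fun hn => absurd hn.1 h⟩
      simp only [hτ.1, hτ.2, ETree.degree, Fin.cases_succ]
      linarith [hα i]

theorem bPlusE_noNoise (ω : List (PB n)) : (bPlusE ω).1.NoNoiseAtRoot := by
  induction ω with
  | nil => trivial
  | cons σ ω ih => exact ⟨rfl, ih⟩

theorem bPlusE_map_phi (ω : List (PT n)) : bPlusE (ω.map phi) = phi (PT.bPlus 0 ω) := by
  induction ω with
  | nil =>
    refine Subtype.ext ?_
    change ETree.point = phiFun (PT.vertex 0)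
    simp [phiFun]
  | cons σ ω ih =>
    refine Subtype.ext ?_
    change ETree.branch 0 (phi σ).1 (bPlusE (ω.map phi)).1 =
      ETree.branch 0 (phi σ).1 (phi (PT.bPlus 0 ω)).1
    rw [ih]

theorem root_phiInv (τ : ETree n) (hτ : τ.NoNoiseAtRoot) : (phiInv τ).root = 0 := by
  induction τ with
  | point => rfl
  | branch d σ τ _ ih =>
    obtain ⟨rfl, h⟩ := hτ
    simpa [phiInv, PT.root] using ih h

/-- The bijection `ω ↦ B₊ (φ ω)` from ordered forests to basis trees of `PB₊`. -/
def bPlusPhi : List (PT n) ≃ PBPlus n where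
  toFun ω := ⟨bPlusE (ω.map phi), bPlusE_noNoise _⟩
  invFun τ := (phi.symm τ.1).branches
  left_inv ω := by simp [bPlusE_map_phi, PT.branches_bPlus]
  right_inv τ := by
    refine Subtype.ext ?_
    have h : (phi.symm τ.1).root = 0 := root_phiInv τ.1.1 τ.2
    have h2 := PT.bPlus_root_branches (phi.symm τ.1)
    rw [h] at h2
    simp [bPlusE_map_phi, h2]

/-- The model space. -/
abbrev PBSpace (n : ℕ) : Type := PB n →₀ ℝ

/-- The space `PB₊`. -/
abbrev PBPlusSpace (n : ℕ) : Type := PBPlus n →₀ ℝ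

/-- The inclusion of `PB₊` in the model space. -/
noncomputable def incl : PBPlusSpace n →ₗ[ℝ] PBSpace n :=
  Finsupp.lmapDomain ℝ ℝ Subtype.val

open Classical in
/-- The projection of the model space onto `PB₊` along the other basis trees. -/
noncomputable def proj : PBSpace n →ₗ[ℝ] PBPlusSpace n :=
  Finsupp.lift _ ℝ _ fun τ =>
    if h : τ.1.NoNoiseAtRoot then Finsupp.single ⟨τ, h⟩ 1 else 0

/-- The linear isomorphism `B₊ ∘ φ` from ordered forests to `PB₊`. -/
noncomputable def bPlusPhiL : OF n ≃ₗ[ℝ] PBPlusSpace n := Finsupp.domLCongr bPlusPhi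

/-- The tree product on `PB₊`: join the roots and shuffle the branches. -/
noncomputable def treeProd : PBPlusSpace n →ₗ[ℝ] PBPlusSpace n →ₗ[ℝ] PBPlusSpace n :=
  Finsupp.lift _ ℝ _ fun σ => Finsupp.lift _ ℝ _ fun τ =>
    ((shuffles (bPlusPhi.symm σ) (bPlusPhi.symm τ)).map fun u =>
      Finsupp.single (bPlusPhi u) (1 : ℝ)).sum

/-- Characters of `PB₊`. -/
def IsCharacter (g : PBPlusSpace n →ₗ[ℝ] ℝ) : Prop :=
  g (Finsupp.single (bPlusPhi []) 1) = 1 ∧ ∀ x y, g (treeProd x y) = g x * g y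

/-- The map `B₋` from trees with exactly one branch, attached by an undecorated edge, to trees. All
other trees are sent to `0`. -/
noncomputable def bMinus : PBSpace n →ₗ[ℝ] PBSpace n :=
  Finsupp.lift _ ℝ _ fun τ =>
    match τ with
    | ⟨.branch d σ .point, h⟩ =>
        if hd : d = 0 then
          Finsupp.single ⟨σ, by simp only [ETree.IsPB, hd, if_true] at h; exact h.1⟩ 1
        else 0
    | _ => 0

/-! ## The coaction `Δ⁺` and the structure group -/

/-- The coaction `Δ⁺` on `B₊ (φ ω)`. -/
noncomputable def deltaPlusRooted : OF n →ₗ[ℝ] PBPlusSpace n ⊗[ℝ] PBSpace n :=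
  TensorProduct.map bPlusPhiL.toLinearMap (incl ∘ₗ bPlusPhiL.toLinearMap) ∘ₗ mkw

open Classical in
/-- The coaction `Δ⁺`: on `B₊ (φ ω)` it is `(B₊ φ ⊗ B₊ φ) Δ_MKW ω`, and on a tree `τ` with a
decorated edge at the root it is `(id ⊗ B₋) (Δ⁺ (B₊ τ) - B₊ τ ⊗ •)`. -/
noncomputable def deltaPlus : PBSpace n →ₗ[ℝ] PBPlusSpace n ⊗[ℝ] PBSpace n :=
  Finsupp.lift _ ℝ _ fun τ =>
    if h : τ.1.NoNoiseAtRoot then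
      deltaPlusRooted (Finsupp.single (bPlusPhi.symm ⟨τ, h⟩) 1)
    else
      LinearMap.lTensor (PBPlusSpace n) bMinus
        (deltaPlusRooted (Finsupp.single [phi.symm τ] 1) -
          (Finsupp.single (bPlusPhi [phi.symm τ]) (1 : ℝ)) ⊗ₜ[ℝ]
            (Finsupp.single pointPB (1 : ℝ)))

/-- The operator `Γ_g = (g ⊗ id) Δ⁺`. -/
noncomputable def gammaOp (g : PBPlusSpace n →ₗ[ℝ] ℝ) : PBSpace n →ₗ[ℝ] PBSpace n :=
  (TensorProduct.lid ℝ (PBSpace n)).toLinearMap ∘ₗ LinearMap.rTensor (PBSpace n) g ∘ₗ deltaPlus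

/-- The structure group: all `Γ_g` with `g` a character of `PB₊`. -/
def structureGroup (n : ℕ) : Set (PBSpace n →ₗ[ℝ] PBSpace n) :=
  {A | ∃ g, IsCharacter g ∧ A = gammaOp g}

/-! ## Models -/

/-- `(Π, Γ)` is a model for the regularity structure whose model space is the span of the basis
`B`, graded by `dg`, with structure group `G`: `Γ` takes values in `G` and satisfies
`Γ x x = id` and `Γ x y ∘ Γ y z = Γ x z`; each `Π x` is linear, takes values in tempered
distributions, is continuous on each homogeneous component (for the `ℓ¹` norm in the tree basis;
the components are finite-dimensional when all `α i > 0`), and `Π x ∘ Γ x y = Π y`. -/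
structure IsModel {B : Type} (dg : B → ℝ) (G : Set ((B →₀ ℝ) →ₗ[ℝ] (B →₀ ℝ)))
    (Pi : ℝ → (B →₀ ℝ) →ₗ[ℝ] (𝓢(ℝ, ℂ) → ℂ))
    (Gam : ℝ → ℝ → (B →₀ ℝ) →ₗ[ℝ] (B →₀ ℝ)) : Prop where
  mem : ∀ x y, Gam x y ∈ G
  refl : ∀ x, Gam x x = LinearMap.id
  comp : ∀ x y z, Gam x y ∘ₗ Gam y z = Gam x z
  tempered : ∀ x v, ∃ u : 𝓢'(ℝ, ℂ), ∀ ψ : 𝓢(ℝ, ℂ), u ψ = Pi x v ψ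
  cont : ∀ (x a : ℝ) (ψ : 𝓢(ℝ, ℂ)), ∃ C : ℝ, ∀ v : B →₀ ℝ, (∀ τ ∈ v.support, dg τ = a) →
    ‖Pi x v ψ‖ ≤ C * ∑ τ ∈ v.support, |v τ|
  recenter : ∀ x y, Pi x ∘ₗ Gam x y = Pi y

/-- The distribution given by integration against a function. -/
noncomputable def functional (f : ℝ → ℝ) : 𝓢(ℝ, ℂ) → ℂ := fun ψ => ∫ t, (f t : ℂ) * ψ t

/-- The distributional derivative. -/
noncomputable def distDeriv (u : 𝓢(ℝ, ℂ) → ℂ) : 𝓢(ℝ, ℂ) → ℂ :=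
  fun ψ => -u (SchwartzMap.derivCLM ℂ ℂ ψ)

open Classical in
/-- The map `Π` of a rough path: `Π_s (B₊ (φ ω)) (t) = ⟨X_st, ω⟩`, and
`Π_s τ = d/dt Π_s (B₊ τ)` when `τ` has a decorated edge at the root. -/
noncomputable def modelPi (X : ℝ → ℝ → OF n →ₗ[ℝ] ℝ) (s : ℝ) :
    PBSpace n →ₗ[ℝ] (𝓢(ℝ, ℂ) → ℂ) :=
  Finsupp.lift _ ℝ _ fun τ =>
    if h : τ.1.NoNoiseAtRoot then
      functional fun t => X s t (Finsupp.single (bPlusPhi.symm ⟨τ, h⟩) 1)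
    else
      distDeriv (functional fun t => X s t (Finsupp.single [phi.symm τ] 1))

/-- The character `γ_st = B₊ (φ X_st)` of `PB₊`. -/
noncomputable def gammaChar (X : ℝ → ℝ → OF n →ₗ[ℝ] ℝ) (s t : ℝ) : PBPlusSpace n →ₗ[ℝ] ℝ :=
  X s t ∘ₗ bPlusPhiL.symm.toLinearMap

/-! ## Time-cotranslation and renormalisation -/

/-- An admissible partition of a tree in which the root belongs to one of the blocks, with this
block still uncontracted: `extracted` lists the other blocks, `block` is the block of the root,
`atRoot` is the forest of (contracted) branches attached to the root that are not in the block, and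
`above` lists the corresponding forests at the other vertices of the block. -/
structure RootBlock (n : ℕ) where
  extracted : List (PT n)
  block : PT n
  atRoot : List (PT n)
  above : List (List (PT n))

/-- Contract the block of the root into a single vertex decorated by `0`, shuffling the branches
that were attached to the vertices of the block. -/
def RootBlock.contract (k : RootBlock n) : List (List (PT n) × PT n) :=
  (shuffleAll (k.atRoot :: k.above)).map fun u => (k.block :: k.extracted, PT.bPlus 0 u)

mutual

/-- Partial partitions of a tree into subtrees such that the root belongs to no block, each given
by its list of blocks and a tree of the contraction of all of them. -/
def uncovered : PT n → List (List (PT n) × PT n)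
  | .vertex c => [([], .vertex c)]
  | .graft σ τ =>
      (uncovered σ ++ (covered σ).flatMap RootBlock.contract).flatMap fun p =>
        (uncovered τ).map fun q => (p.1 ++ q.1, .graft p.2 q.2)

/-- Partial partitions of a tree into subtrees such that the root belongs to a block. Admissibility:
if an edge belongs to a block, so do all edges to its right at the same vertex. Hence in
`graft σ τ` the new leftmost edge either is not in the block of the root, or it is, together with
all other edges at the root. -/
def covered : PT n → List (RootBlock n)
  | .vertex c => [⟨[], .vertex c, [], []⟩]
  | .graft σ τ =>
      ((uncovered σ ++ (covered σ).flatMap RootBlock.contract).flatMap fun p =>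
        (covered τ).map fun k =>
          ⟨p.1 ++ k.extracted, k.block, p.2 :: k.atRoot, k.above⟩) ++
      (covered σ).flatMap fun k =>
        ((covered τ).filter fun l => l.atRoot.isEmpty).map fun l =>
          ⟨k.extracted ++ l.extracted, .graft k.block l.block, [],
            k.atRoot :: (k.above ++ l.above)⟩

end

/-- All admissible partitions of a tree into disjoint, not necessarily spanning, subtrees, with the
terms of the contraction of all blocks into vertices decorated by `0`. -/
def partitions (τ : PT n) : List (List (PT n) × PT n) :=
  uncovered τ ++ (covered τ).flatMap RootBlock.contract

/-- The time-cotranslation on trees, with values in the symmetric algebra of the space of trees: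
the sum over all admissible partitions of the product of the blocks, tensor the contraction. (The
partitions having a block with several roots extract Lie polynomials of length at least two; these
have no component in the space of trees and are annihilated by the projection `π⁻`.) -/
noncomputable def timeCotranslation :
    (PT n →₀ ℝ) →ₗ[ℝ] MvPolynomial (PT n) ℝ ⊗[ℝ] (PT n →₀ ℝ) :=
  Finsupp.lift _ ℝ _ fun τ =>
    ((partitions τ).map fun p =>
      (p.1.map fun σ => (MvPolynomial.X σ : MvPolynomial (PT n) ℝ)).prod ⊗ₜ[ℝ]
        (Finsupp.single p.2 (1 : ℝ))).sum

/-- The trees of negative degree. -/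
abbrev PBNeg (α : Fin n → ℝ) : Type := {τ : PB n // deg α τ < 0}

/-- The free commutative algebra generated by the trees of negative degree. -/
abbrev SPBNeg (α : Fin n → ℝ) : Type := MvPolynomial (PBNeg α) ℝ

open Classical in
/-- The algebra morphism that transports trees by `φ` and projects onto the trees of negative
degree: `φ ∘ π⁻`. -/
noncomputable def phiProjNeg (α : Fin n → ℝ) : MvPolynomial (PT n) ℝ →ₐ[ℝ] SPBNeg α :=
  MvPolynomial.aeval fun τ =>
    if h : deg α (phi τ) < 0 then MvPolynomial.X ⟨phi τ, h⟩ else 0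

/-- The coaction `Δ⁻ = (φ ⊗ φ) (π⁻ ⊗ id) ρ₀ φ⁻¹`. -/
noncomputable def deltaMinus (α : Fin n → ℝ) : PBSpace n →ₗ[ℝ] SPBNeg α ⊗[ℝ] PBSpace n :=
  TensorProduct.map (phiProjNeg α).toLinearMap (Finsupp.domLCongr phi).toLinearMap ∘ₗ
    timeCotranslation ∘ₗ (Finsupp.domLCongr phi.symm).toLinearMap

/-- The renormalisation map `M_ℓ = (ℓ ⊗ id) Δ⁻`. -/
noncomputable def renorm {α : Fin n → ℝ} (ℓ : SPBNeg α →ₐ[ℝ] ℝ) : PBSpace n →ₗ[ℝ] PBSpace n :=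
  (TensorProduct.lid ℝ (PBSpace n)).toLinearMap ∘ₗ
    LinearMap.rTensor (PBSpace n) ℓ.toLinearMap ∘ₗ deltaMinus α

/-- The renormalised map `Π_s M_ℓ`. -/
noncomputable def renormPi {α : Fin n → ℝ} (X : ℝ → ℝ → OF n →ₗ[ℝ] ℝ) (ℓ : SPBNeg α →ₐ[ℝ] ℝ)
    (s : ℝ) : PBSpace n →ₗ[ℝ] (𝓢(ℝ, ℂ) → ℂ) :=
  modelPi X s ∘ₗ renorm ℓ

/-- The renormalised map `(γ_ts M_ℓ ⊗ id) Δ⁺`. The projection only expresses that `M_ℓ x` is read as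
an element of `PB₊` for `x` in `PB₊`. -/
noncomputable def renormGamma {α : Fin n → ℝ} (X : ℝ → ℝ → OF n →ₗ[ℝ] ℝ)
    (ℓ : SPBNeg α →ₐ[ℝ] ℝ) (s t : ℝ) : PBSpace n →ₗ[ℝ] PBSpace n :=
  gammaOp (gammaChar X t s ∘ₗ proj ∘ₗ renorm ℓ ∘ₗ incl)

end PlanarRP

open PlanarRP

namespace PlanarRP

variable {n : ℕ}

local notation "δ" a:max => Finsupp.single a (1 : ℝ)

/-! ## Linear maps between spaces with a basis -/

-- Write `A` for `contraction w`, the sum of all contractions of a tree with each block `σ` weighted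
-- by `w σ = ℓ(φ(π⁻ σ))`, and `Â` for `letterwise A`, its extension to words letter by letter. As
-- `ℓ` is multiplicative, `φ` carries `A` to `M_ℓ` (`renorm_phiL`). Both clauses of `Δ⁺` become one
-- coaction `ρ` of forests on trees, given by left admissible cuts (`deltaPlus_phiL`), so `Γ_g`
-- becomes `T_g = (g ⊗ id) ρ` on trees (`treeAction`). Its companion on forests is `(g ⊗ id) Δ_MKW`
-- (`forestAction`), also called `T_g` below.
--
-- The algebra rests on `contraction_bPlusL`: `A B₊^c = B₊^c Â + B₊^0 Â (id ⊗ f_c) Δ_MKW` with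
-- `f_c(ω) = w(B₊^c ω)`. In the first term the root lies in no block. In the second, the block of
-- the root is the trunk of a left admissible cut, because a family of edges closed to the right is
-- the complement of one closed to the left. A tree with root decoration `0` has nonnegative degree
-- and hence weight zero, so `A B₊^0 = B₊^0 Â`: the map `M_ℓ` preserves `PB₊` and acts there as `Â`.
-- Since `Â` respects shuffles, `g ∘ Â` is a character whenever `g` is one. Coassociativity and
-- induction on the number of vertices then give the intertwining `T_g A = A T_{g ∘ Â}`
-- (`forestAction_letterwise`, `treeAction_comm`). The induction strips the rightmost tree by `Δ(ωt)
-- = Δ(ω)·ρ(t) + ωt ⊗ 1` (`mkw_concat`), where the dot shuffles on the left and concatenates on the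
-- right.
--
-- On trees `Γ^{M_ℓ}_{xy}` is thus `T_g` with `g = X_yx ∘ Â`. The cocycle identity follows from `T_f
-- T_g = T_{f ∘ T_g}`, the intertwining and Chen's relation. Chen's relation also makes `X_ss`
-- idempotent, hence equal to the counit, whence `Γ_xx = id`. Since `B₊^0` is integration, `Π_s(φ τ)
-- = d/dt X_st(τ)` for every tree `τ`. Changing the base point by Chen's relation alters this
-- primitive only by a constant, which the derivative kills, and the intertwining carries `M_ℓ`
-- across. Components of `X` are continuous of polynomial growth, so all distributions are tempered.
-- Positivity of the `α i` leaves finitely many trees in each degree, which gives the continuity.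

theorem basis_induction {A : Type*} {p : (A →₀ ℝ) → Prop} (x : A →₀ ℝ) (zero : p 0)
    (basis : ∀ a, p (δ a)) (add : ∀ x y, p x → p y → p (x + y))
    (smul : ∀ (r : ℝ) x, p x → p (r • x)) : p x := by
  induction x using Finsupp.induction_linear with
  | zero => exact zero
  | add x y hx hy => exact add x y hx hy
  | single a r =>
    have := smul r _ (basis a)
    rwa [Finsupp.smul_single, smul_eq_mul, mul_one] at this

theorem linearMap_ext_basis {A V : Type*} [AddCommMonoid V] [Module ℝ V]
    {f g : (A →₀ ℝ) →ₗ[ℝ] V} (h : ∀ a, f (δ a) = g (δ a)) : f = g :=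
  Finsupp.lhom_ext' fun a => LinearMap.ext_ring (h a)

theorem linearMap_apply_eq_of_basis {A V : Type*} [AddCommMonoid V] [Module ℝ V]
    {f g : (A →₀ ℝ) →ₗ[ℝ] V} (h : ∀ a, f (δ a) = g (δ a)) (x : A →₀ ℝ) : f x = g x := by
  rw [linearMap_ext_basis h]

/-- The sum of the basis vectors of a list. -/
noncomputable def ofList {A : Type*} (L : List A) : A →₀ ℝ := (L.map fun a => δ a).sum

@[simp] theorem ofList_nil {A : Type*} : ofList ([] : List A) = 0 := rfl

@[simp] theorem ofList_cons {A : Type*} (a : A) (L : List A) :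
    ofList (a :: L) = δ a + ofList L := by simp [ofList]

@[simp] theorem ofList_append {A : Type*} (L L' : List A) :
    ofList (L ++ L') = ofList L + ofList L' := by simp [ofList]

theorem map_ofList {A V : Type*} [AddCommMonoid V] [Module ℝ V] (f : (A →₀ ℝ) →ₗ[ℝ] V)
    (L : List A) : f (ofList L) = (L.map fun a => f (δ a)).sum := by
  simp [ofList, map_list_sum, List.map_map, Function.comp_def]

/-! ## Concatenation, grafting and shuffle as linear maps -/

/-- The span of the planar rooted trees. -/
abbrev TS (n : ℕ) : Type := PT n →₀ ℝ

/-- A tree as a forest with one tree. -/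
noncomputable def letter : TS n →ₗ[ℝ] OF n := Finsupp.lmapDomain ℝ ℝ fun t => [t]

/-- Concatenation of forests. -/
noncomputable def cat : OF n →ₗ[ℝ] OF n →ₗ[ℝ] OF n :=
  Finsupp.lift _ ℝ _ fun u => Finsupp.lmapDomain ℝ ℝ fun v => u ++ v

/-- The map `B₊` on the span of the forests. -/
noncomputable def bPlusL (c : Fin (n + 1)) : OF n →ₗ[ℝ] TS n :=
  Finsupp.lmapDomain ℝ ℝ (PT.bPlus c)

/-- The map `B₋` on the span of the trees. -/
noncomputable def branchesL : TS n →ₗ[ℝ] OF n := Finsupp.lmapDomain ℝ ℝ PT.branches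

/-- Grafting a tree as leftmost branch. -/
noncomputable def graftL : TS n →ₗ[ℝ] TS n →ₗ[ℝ] TS n :=
  Finsupp.lift _ ℝ _ fun σ => Finsupp.lmapDomain ℝ ℝ (PT.graft σ)

@[simp] theorem letter_single (t : PT n) : letter (δ t) = δ [t] := by simp [letter]

@[simp] theorem cat_single (u v : List (PT n)) : cat (δ u) (δ v) = δ (u ++ v) := by simp [cat]

@[simp] theorem bPlusL_single (c : Fin (n + 1)) (ω : List (PT n)) :
    bPlusL c (δ ω) = δ (PT.bPlus c ω) := by simp [bPlusL]

@[simp] theorem branchesL_single (τ : PT n) : branchesL (δ τ) = δ τ.branches := by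
  simp [branchesL]

@[simp] theorem graftL_single (σ τ : PT n) : graftL (δ σ) (δ τ) = δ (PT.graft σ τ) := by
  simp [graftL]

theorem bPlusL_cat_letter (c : Fin (n + 1)) (a : TS n) (x : OF n) :
    bPlusL c (cat (letter a) x) = graftL a (bPlusL c x) := by
  induction a using basis_induction with
  | zero => simp
  | add a b ha hb => simp [ha, hb]
  | smul r a ha => simp [ha]
  | basis a =>
    induction x using basis_induction with
    | zero => simp
    | add a b ha hb => simp only [map_add, ha, hb]
    | smul r a ha => simp only [map_smul, ha]
    | basis x => simp [PT.bPlus]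

theorem branchesL_graftL (a b : TS n) :
    branchesL (graftL a b) = cat (letter a) (branchesL b) := by
  induction a using basis_induction with
  | zero => simp
  | add a b ha hb => simp [ha, hb]
  | smul r a ha => simp [ha]
  | basis a =>
    induction b using basis_induction with
    | zero => simp
    | add a b ha hb => simp only [map_add, ha, hb]
    | smul r a ha => simp only [map_smul, ha]
    | basis x => simp [PT.branches]

@[simp] theorem cat_one_left (x : OF n) : cat (δ []) x = x :=
  linearMap_apply_eq_of_basis (f := cat (δ [])) (g := LinearMap.id) (fun a => by simp) x

@[simp] theorem cat_one_right (x : OF n) : cat x (δ []) = x :=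
  linearMap_apply_eq_of_basis (f := cat.flip (δ [])) (g := LinearMap.id) (fun a => by simp) x

theorem cat_assoc (x y z : OF n) : cat (cat x y) z = cat x (cat y z) := by
  induction x using basis_induction with
  | zero => simp
  | add a b ha hb => simp [ha, hb]
  | smul r a ha => simp [ha]
  | basis u =>
    induction y using basis_induction with
    | zero => simp
    | add a b ha hb => simp only [map_add, LinearMap.add_apply, ha, hb]
    | smul r a ha => simp only [map_smul, LinearMap.smul_apply, ha]
    | basis v =>
      induction z using basis_induction with
      | zero => simp
      | add a b ha hb => simp only [map_add, ha, hb]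
      | smul r a ha => simp only [map_smul, ha]
      | basis w => simp

theorem shuffle_single (u v : List (PT n)) :
    shuffle (δ u) (δ v) = ofList (shuffles u v) := by
  simp [shuffle, ofList]

theorem shuffles_nil_left (v : List (PT n)) : shuffles [] v = [v] := by
  rw [shuffles]

theorem shuffles_nil_right (v : List (PT n)) : shuffles v [] = [v] := by
  cases v <;> rw [shuffles]

@[simp] theorem shuffle_one_left (x : OF n) : shuffle (δ []) x = x :=
  linearMap_apply_eq_of_basis (f := shuffle (δ [])) (g := LinearMap.id)
    (fun a => by simp [shuffle_single, shuffles_nil_left]) x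

@[simp] theorem shuffle_one_right (x : OF n) : shuffle x (δ []) = x :=
  linearMap_apply_eq_of_basis (f := shuffle.flip (δ [])) (g := LinearMap.id)
    (fun a => by simp [shuffle_single, shuffles_nil_right]) x

theorem ofList_map_cons (a : PT n) (L : List (List (PT n))) :
    ofList (L.map (a :: ·)) = cat (δ [a]) (ofList L) := by
  rw [map_ofList]; simp [ofList, List.map_map, Function.comp_def]

theorem shuffle_cons_cons (a b : PT n) (u v : List (PT n)) :
    shuffle (δ (a :: u)) (δ (b :: v)) =
      cat (δ [a]) (shuffle (δ u) (δ (b :: v))) + cat (δ [b]) (shuffle (δ (a :: u)) (δ v)) := by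
  rw [shuffle_single, shuffles, ofList_append, ofList_map_cons, ofList_map_cons, shuffle_single,
    shuffle_single]

theorem shuffle_cat_cons (a c : PT n) (x : OF n) (w : List (PT n)) :
    shuffle (cat (δ [a]) x) (δ (c :: w)) =
      cat (δ [a]) (shuffle x (δ (c :: w))) + cat (δ [c]) (shuffle (cat (δ [a]) x) (δ w)) := by
  induction x using basis_induction with
  | zero => simp
  | add x y hx hy => simp only [map_add, LinearMap.add_apply, hx, hy]; abel
  | smul r x hx => simp only [map_smul, LinearMap.smul_apply, hx, smul_add]
  | basis u => simp only [cat_single, List.singleton_append, shuffle_cons_cons]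

theorem shuffle_cons_cat (a c : PT n) (x : OF n) (w : List (PT n)) :
    shuffle (δ (c :: w)) (cat (δ [a]) x) =
      cat (δ [c]) (shuffle (δ w) (cat (δ [a]) x)) + cat (δ [a]) (shuffle (δ (c :: w)) x) := by
  induction x using basis_induction with
  | zero => simp
  | add x y hx hy => simp only [map_add, hx, hy]; abel
  | smul r x hx => simp only [map_smul, hx, smul_add]
  | basis u => simp only [cat_single, List.singleton_append, shuffle_cons_cons]

/-- Both sides split according to which word supplies the first letter, and each of the three parts
is an instance with one letter fewer. -/
theorem shuffle_assoc_single : ∀ u v w : List (PT n),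
    shuffle (shuffle (δ u) (δ v)) (δ w) = shuffle (δ u) (shuffle (δ v) (δ w))
  | [], v, w => by simp
  | a :: u, [], w => by simp
  | a :: u, b :: v, [] => by simp
  | a :: u, b :: v, c :: w => by
    have h1 := shuffle_assoc_single u (b :: v) (c :: w)
    have h2 := shuffle_assoc_single (a :: u) v (c :: w)
    have h3 := shuffle_assoc_single (a :: u) (b :: v) w
    -- The words beginning with `c` come in two groups on the left side; expanding `h3` lets them be
    -- collected.
    rw [shuffle_cons_cons a b u v, map_add, LinearMap.add_apply] at h3
    rw [shuffle_cons_cons a b u v, map_add, LinearMap.add_apply, shuffle_cat_cons,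
      shuffle_cat_cons, h1, h2, shuffle_cons_cons b c v w]
    simp only [map_add, shuffle_cons_cat]
    rw [← h3]
    simp only [map_add]
    abel
termination_by u v w => u.length + v.length + w.length

theorem shuffle_assoc (x y z : OF n) : shuffle (shuffle x y) z = shuffle x (shuffle y z) := by
  induction x using basis_induction with
  | zero => simp
  | add a b ha hb => simp [ha, hb]
  | smul r a ha => simp [ha]
  | basis u =>
    induction y using basis_induction with
    | zero => simp
    | add a b ha hb => simp only [map_add, LinearMap.add_apply, ha, hb]
    | smul r a ha => simp only [map_smul, LinearMap.smul_apply, ha]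
    | basis v =>
      induction z using basis_induction with
      | zero => simp
      | add a b ha hb => simp only [map_add, ha, hb]
      | smul r a ha => simp only [map_smul, ha]
      | basis w => exact shuffle_assoc_single u v w

/-- The definition of the shuffle peels off first letters. Peeling off last letters is what matches
the recursion of the coproduct, which runs from the right. -/
theorem shuffle_concat_concat : ∀ (u v : List (PT n)) (a b : PT n),
    shuffle (δ (u ++ [a])) (δ (v ++ [b])) =
      cat (shuffle (δ u) (δ (v ++ [b]))) (δ [a]) + cat (shuffle (δ (u ++ [a])) (δ v)) (δ [b])
  | [], [], a, b => by
    simp only [List.nil_append, shuffle_cons_cons]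
    simp [add_comm]
  | [], d :: v, a, b => by
    have h := shuffle_concat_concat [] v a b
    simp only [List.nil_append, List.cons_append, shuffle_cons_cons, shuffle_one_left,
      cat_single, map_add, LinearMap.add_apply, cat_assoc] at h ⊢
    simp only [h, map_add, cat_single, List.cons_append, List.nil_append]
    abel
  | c :: u, [], a, b => by
    have h := shuffle_concat_concat u [] a b
    simp only [List.nil_append, List.cons_append, shuffle_cons_cons, shuffle_one_right,
      cat_single, map_add, LinearMap.add_apply, cat_assoc] at h ⊢
    simp only [h, map_add, cat_single, List.cons_append, List.nil_append]
    abel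
  | c :: u, d :: v, a, b => by
    have h1 := shuffle_concat_concat u (d :: v) a b
    have h2 := shuffle_concat_concat (c :: u) v a b
    simp only [List.cons_append] at h1 h2 ⊢
    simp only [shuffle_cons_cons, h1, h2, map_add, LinearMap.add_apply, cat_assoc]
    abel
termination_by u v => u.length + v.length

/-- Last letters are allowed to be linear combinations of trees, since a contracted or recentred
tree is one. -/
theorem shuffle_cat_letter (x y : OF n) (a b : TS n) :
    shuffle (cat x (letter a)) (cat y (letter b)) =
      cat (shuffle x (cat y (letter b))) (letter a) +
        cat (shuffle (cat x (letter a)) y) (letter b) := by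
  induction x using basis_induction with
  | zero => simp
  | add x y hx hy => simp only [map_add, LinearMap.add_apply, hx, hy]; abel
  | smul r x hx => simp only [map_smul, LinearMap.smul_apply, hx, smul_add]
  | basis u =>
  induction y using basis_induction with
  | zero => simp
  | add x y hx hy => simp only [map_add, LinearMap.add_apply, hx, hy]; abel
  | smul r x hx => simp only [map_smul, LinearMap.smul_apply, hx, smul_add]
  | basis v =>
  induction a using basis_induction with
  | zero => simp
  | add x y hx hy => simp only [map_add, LinearMap.add_apply, hx, hy]; abel
  | smul r x hx => simp only [map_smul, LinearMap.smul_apply, hx, smul_add]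
  | basis a =>
  induction b using basis_induction with
  | zero => simp
  | add x y hx hy => simp only [map_add, LinearMap.add_apply, hx, hy]; abel
  | smul r x hx => simp only [map_smul, LinearMap.smul_apply, hx, smul_add]
  | basis b => simpa using shuffle_concat_concat u v a b

/-- The sum of all shuffles of a family of words. -/
noncomputable def shuffleAllL (ws : List (List (PT n))) : OF n := ofList (shuffleAll ws)

@[simp] theorem shuffleAllL_nil : shuffleAllL ([] : List (List (PT n))) = δ [] := by
  simp [shuffleAllL, shuffleAll]

@[simp] theorem shuffleAllL_cons (w : List (PT n)) (ws : List (List (PT n))) :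
    shuffleAllL (w :: ws) = shuffle (δ w) (shuffleAllL ws) := by
  rw [shuffleAllL, shuffleAllL, map_ofList, shuffleAll]
  induction shuffleAll ws with
  | nil => simp
  | cons u L ih => simp [shuffle_single, ih]

theorem shuffleAllL_append (vs ws : List (List (PT n))) :
    shuffleAllL (vs ++ ws) = shuffle (shuffleAllL vs) (shuffleAllL ws) := by
  induction vs with
  | nil => simp
  | cons v vs ih => simp [ih, shuffle_assoc]

/-! ## Letterwise extensions of maps of trees -/

/-- The letterwise extension of a linear map of trees, on a basis forest. -/
noncomputable def letterwiseWord (A : TS n →ₗ[ℝ] TS n) : List (PT n) → OF n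
  | [] => δ []
  | t :: ω => cat (letter (A (δ t))) (letterwiseWord A ω)

/-- The letterwise extension of a linear map of trees to forests. -/
noncomputable def letterwise (A : TS n →ₗ[ℝ] TS n) : OF n →ₗ[ℝ] OF n :=
  Finsupp.lift _ ℝ _ (letterwiseWord A)

variable (A : TS n →ₗ[ℝ] TS n)

@[simp] theorem letterwise_one : letterwise A (δ []) = δ [] := by
  simp [letterwise, letterwiseWord]

theorem letterwise_cons (t : PT n) (ω : List (PT n)) :
    letterwise A (δ (t :: ω)) = cat (letter (A (δ t))) (letterwise A (δ ω)) := by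
  simp [letterwise, letterwiseWord]

theorem letterwise_cat (x y : OF n) :
    letterwise A (cat x y) = cat (letterwise A x) (letterwise A y) := by
  induction x using basis_induction with
  | zero => simp
  | add a b ha hb => simp [ha, hb]
  | smul r a ha => simp [ha]
  | basis u =>
    induction y using basis_induction with
    | zero => simp
    | add a b ha hb => simp only [map_add, ha, hb]
    | smul r a ha => simp only [map_smul, ha]
    | basis v =>
      rw [cat_single]
      induction u with
      | nil => simp
      | cons t u ih => rw [List.cons_append, letterwise_cons, letterwise_cons, ih, cat_assoc]

theorem letterwise_letter (a : TS n) : letterwise A (letter a) = letter (A a) :=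
  linearMap_apply_eq_of_basis (f := letterwise A ∘ₗ letter) (g := letter ∘ₗ A)
    (fun a => by simp [letterwise_cons]) a

theorem letterwise_concat (t : PT n) (ω : List (PT n)) :
    letterwise A (δ (ω ++ [t])) = cat (letterwise A (δ ω)) (letter (A (δ t))) := by
  rw [← cat_single, letterwise_cat, ← letter_single, letterwise_letter]

/-- A shuffle only permutes letters, so it commutes with any substitution made letter by letter. -/
theorem letterwise_shuffle (x y : OF n) :
    letterwise A (shuffle x y) = shuffle (letterwise A x) (letterwise A y) := by
  induction x using basis_induction with
  | zero => simp
  | add a b ha hb => simp [ha, hb]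
  | smul r a ha => simp [ha]
  | basis u =>
    induction y using basis_induction with
    | zero => simp
    | add a b ha hb => simp only [map_add, ha, hb]
    | smul r a ha => simp only [map_smul, ha]
    | basis v =>
      induction u using List.reverseRecOn generalizing v with
      | nil => simp
      | append_singleton u a ihu =>
        induction v using List.reverseRecOn with
        | nil => simp
        | append_singleton v b ihv =>
          rw [shuffle_concat_concat, map_add, letterwise_cat, letterwise_cat, ihu, ihv,
            letterwise_concat, letterwise_concat, shuffle_cat_letter, ← letter_single,
            letterwise_letter, ← letter_single, letterwise_letter]

/-! ## The left admissible cuts as a linear map -/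

section

variable {U V W : Type*} [AddCommMonoid U] [Module ℝ U] [AddCommMonoid V] [Module ℝ V]
  [AddCommMonoid W] [Module ℝ W]

theorem sum_map_flatMap {A B V : Type*} [AddCommMonoid V] (L : List A) (f : A → List B) (g : B → V) :
    ((L.flatMap f).map g).sum = (L.map fun a => ((f a).map g).sum).sum := by
  induction L with
  | nil => simp
  | cons a L ih => simp [ih]

theorem bilinear_sum_sum {A B : Type*} (F : U →ₗ[ℝ] V →ₗ[ℝ] W) (L : List A) (L' : List B)
    (a : A → U) (b : B → V) :
    F (L.map a).sum (L'.map b).sum = (L.map fun k => (L'.map fun l => F (a k) (b l)).sum).sum := by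
  induction L with
  | nil => simp
  | cons k L ih =>
    rw [List.map_cons, List.sum_cons, map_add, LinearMap.add_apply, ih, List.map_cons,
      List.sum_cons, map_list_sum, List.map_map]
    rfl

/-- Evaluation of the left factor of a tensor by a linear form. -/
noncomputable def evalLeft (V : Type*) [AddCommMonoid V] [Module ℝ V] (g : OF n →ₗ[ℝ] ℝ) :
    OF n ⊗[ℝ] V →ₗ[ℝ] V :=
  (TensorProduct.lid ℝ V).toLinearMap ∘ₗ LinearMap.rTensor V g

@[simp] theorem evalLeft_tmul (g : OF n →ₗ[ℝ] ℝ) (x : OF n) (v : V) :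
    evalLeft V g (x ⊗ₜ v) = g x • v := by simp [evalLeft]

theorem evalLeft_lTensor (g : OF n →ₗ[ℝ] ℝ) (f : V →ₗ[ℝ] W) (z : OF n ⊗[ℝ] V) :
    evalLeft W g (LinearMap.lTensor (OF n) f z) = f (evalLeft V g z) := by
  induction z with
  | zero => simp
  | add x y hx hy => simp only [map_add, hx, hy]
  | tmul x v => simp

theorem evalLeft_rTensor (g : OF n →ₗ[ℝ] ℝ) (f : OF n →ₗ[ℝ] OF n) (z : OF n ⊗[ℝ] V) :
    evalLeft V g (LinearMap.rTensor V f z) = evalLeft V (g ∘ₗ f) z := by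
  induction z with
  | zero => simp
  | add x y hx hy => simp only [map_add, hx, hy]
  | tmul x v => simp

/-- Evaluation of the right factor of a tensor by a linear form. -/
noncomputable def evalRight (g : V →ₗ[ℝ] ℝ) : OF n ⊗[ℝ] V →ₗ[ℝ] OF n :=
  (TensorProduct.rid ℝ (OF n)).toLinearMap ∘ₗ LinearMap.lTensor (OF n) g

@[simp] theorem evalRight_tmul (g : V →ₗ[ℝ] ℝ) (x : OF n) (v : V) :
    evalRight g (x ⊗ₜ v) = g v • x := by simp [evalRight]

theorem evalRight_rTensor (g : V →ₗ[ℝ] ℝ) (f : OF n →ₗ[ℝ] OF n) (z : OF n ⊗[ℝ] V) :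
    evalRight g (LinearMap.rTensor V f z) = f (evalRight g z) := by
  induction z with
  | zero => simp
  | add x y hx hy => simp only [map_add, hx, hy]
  | tmul x v => simp

theorem evalRight_lTensor (g : W →ₗ[ℝ] ℝ) (f : V →ₗ[ℝ] W) (z : OF n ⊗[ℝ] V) :
    evalRight g (LinearMap.lTensor (OF n) f z) = evalRight (g ∘ₗ f) z := by
  induction z with
  | zero => simp
  | add x y hx hy => simp only [map_add, hx, hy]
  | tmul x v => simp

/-- Shuffle the first two factors. -/
noncomputable def shuffleLeft (V : Type*) [AddCommMonoid V] [Module ℝ V] :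
    OF n ⊗[ℝ] (OF n ⊗[ℝ] V) →ₗ[ℝ] OF n ⊗[ℝ] V :=
  LinearMap.rTensor V (TensorProduct.lift shuffle) ∘ₗ
    (TensorProduct.assoc ℝ (OF n) (OF n) V).symm.toLinearMap

@[simp] theorem shuffleLeft_tmul (x y : OF n) (v : V) :
    shuffleLeft V (x ⊗ₜ (y ⊗ₜ v)) = shuffle x y ⊗ₜ v := by simp [shuffleLeft]

theorem lTensor_shuffleLeft (f : V →ₗ[ℝ] W) (z : OF n ⊗[ℝ] (OF n ⊗[ℝ] V)) :
    LinearMap.lTensor (OF n) f (shuffleLeft V z) =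
      shuffleLeft W (LinearMap.lTensor (OF n) (LinearMap.lTensor (OF n) f) z) := by
  induction z with
  | zero => simp
  | add x y hx hy => simp only [map_add, hx, hy]
  | tmul x z =>
    induction z with
    | zero => simp
    | add x y hx hy => simp only [TensorProduct.tmul_add, map_add, hx, hy]
    | tmul y v => simp

/-- The linear form that is `1` on the empty forest and `0` on all other forests. -/
noncomputable def counit : OF n →ₗ[ℝ] ℝ := Finsupp.lapply []

@[simp] theorem counit_one : counit (δ ([] : List (PT n))) = 1 := by simp [counit]

theorem counit_single {ω : List (PT n)} (h : ω ≠ []) : counit (δ ω) = 0 := by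
  simp [counit, h]

theorem counit_cat_letter_left (a : TS n) (x : OF n) : counit (cat (letter a) x) = 0 := by
  induction a using basis_induction with
  | zero => simp
  | add a b ha hb => simp [ha, hb]
  | smul r a ha => simp [ha]
  | basis a =>
    induction x using basis_induction with
    | zero => simp
    | add a b ha hb => simp only [map_add, ha, hb, add_zero]
    | smul r a ha => simp only [map_smul, ha, smul_zero]
    | basis u => simp [counit_single]

theorem counit_cat_letter_right (a : TS n) (x : OF n) : counit (cat x (letter a)) = 0 := by
  induction x using basis_induction with
  | zero => simp
  | add a b ha hb => simp [ha, hb]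
  | smul r a ha => simp [ha]
  | basis x =>
    induction a using basis_induction with
    | zero => simp
    | add a b ha hb => simp only [map_add, ha, hb, add_zero]
    | smul r a ha => simp only [map_smul, ha, smul_zero]
    | basis u => simp [counit_single]

end

/-- Shuffle the left factors and graft the right factors. -/
noncomputable def shuffleGraft : OF n ⊗[ℝ] TS n →ₗ[ℝ] OF n ⊗[ℝ] TS n →ₗ[ℝ] OF n ⊗[ℝ] TS n :=
  TensorProduct.map₂ shuffle graftL

@[simp] theorem shuffleGraft_tmul (x y : OF n) (a b : TS n) :
    shuffleGraft (x ⊗ₜ a) (y ⊗ₜ b) = shuffle x y ⊗ₜ graftL a b := by simp [shuffleGraft]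

/-- Shuffle the left factors and concatenate the right factors. -/
noncomputable def shuffleCat : OF n ⊗[ℝ] OF n →ₗ[ℝ] OF n ⊗[ℝ] OF n →ₗ[ℝ] OF n ⊗[ℝ] OF n :=
  TensorProduct.map₂ shuffle cat

@[simp] theorem shuffleCat_tmul (x y a b : OF n) :
    shuffleCat (x ⊗ₜ a) (y ⊗ₜ b) = shuffle x y ⊗ₜ cat a b := by simp [shuffleCat]

theorem shuffleCat_assoc (x y z : OF n ⊗[ℝ] OF n) :
    shuffleCat (shuffleCat x y) z = shuffleCat x (shuffleCat y z) := by
  induction x with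
  | zero => simp
  | add a b ha hb => simp only [map_add, LinearMap.add_apply, ha, hb]
  | tmul x₁ x₂ =>
    induction y with
    | zero => simp
    | add a b ha hb => simp only [map_add, LinearMap.add_apply, ha, hb]
    | tmul y₁ y₂ =>
      induction z with
      | zero => simp
      | add a b ha hb => simp only [map_add, ha, hb]
      | tmul z₁ z₂ => simp [shuffle_assoc, cat_assoc]

theorem shuffleCat_one_right (x : OF n ⊗[ℝ] OF n) : shuffleCat x ((δ []) ⊗ₜ (δ [])) = x := by
  induction x with
  | zero => simp
  | add a b ha hb => simp only [map_add, LinearMap.add_apply, ha, hb]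
  | tmul x₁ x₂ => simp

theorem shuffleCat_one_left (x : OF n ⊗[ℝ] OF n) : shuffleCat ((δ []) ⊗ₜ (δ [])) x = x := by
  induction x with
  | zero => simp
  | add a b ha hb => simp only [map_add, ha, hb]
  | tmul x₁ x₂ => simp

theorem lTensor_branchesL_shuffleGraft (x y : OF n ⊗[ℝ] TS n) :
    LinearMap.lTensor (OF n) branchesL (shuffleGraft x y) =
      shuffleCat (LinearMap.lTensor (OF n) letter x) (LinearMap.lTensor (OF n) branchesL y) := by
  induction x with
  | zero => simp
  | add a b ha hb => simp only [map_add, LinearMap.add_apply, ha, hb]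
  | tmul x₁ x₂ =>
    induction y with
    | zero => simp
    | add a b ha hb => simp only [map_add, ha, hb]
    | tmul y₁ y₂ => simp [branchesL_graftL]

/-- The sum over all left admissible cuts of a tree of the forest cut off from the root, tensor the
shuffle of the other pruned forests, tensor the trunk. -/
noncomputable def cutTensor (τ : PT n) : OF n ⊗[ℝ] (OF n ⊗[ℝ] TS n) :=
  ((leftCuts τ).map fun k => (δ k.atRoot) ⊗ₜ[ℝ] (shuffleAllL k.above ⊗ₜ[ℝ] (δ k.trunk))).sum

/-- The coaction of the forests on the trees: the sum over all left admissible cuts of the shuffle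
of the pruned forests, tensor the trunk. -/
noncomputable def cutCoaction : TS n →ₗ[ℝ] OF n ⊗[ℝ] TS n :=
  Finsupp.lift _ ℝ _ fun τ => shuffleLeft (TS n) (cutTensor τ)

@[simp] theorem cutCoaction_single (τ : PT n) :
    cutCoaction (δ τ) = shuffleLeft (TS n) (cutTensor τ) := by simp [cutCoaction]

theorem shuffleLeft_cutTensor (τ : PT n) : shuffleLeft (TS n) (cutTensor τ) =
    ((leftCuts τ).map fun k =>
      shuffleAllL (k.atRoot :: k.above) ⊗ₜ[ℝ] (δ k.trunk)).sum := by
  simp [cutTensor, map_list_sum, List.map_map, Function.comp_def]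

/-- The cuts without cut edge at the root. -/
noncomputable def rootUncut (τ : PT n) : OF n ⊗[ℝ] TS n :=
  evalLeft _ counit (cutTensor τ)

/-- Evaluation by the counit is the linear form of the filter "nothing is cut off at the root" in
`leftCuts` and `covered`. -/
theorem evalLeft_counit_sum {A V : Type*} [AddCommMonoid V] [Module ℝ V] (L : List A)
    (f : A → List (PT n)) (g : A → V) :
    evalLeft V counit ((L.map fun k => (δ (f k)) ⊗ₜ[ℝ] g k).sum) =
      ((L.filter fun k => (f k).isEmpty).map g).sum := by
  induction L with
  | nil => simp
  | cons k L ih =>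
    rw [List.map_cons, List.sum_cons, map_add, ih, evalLeft_tmul, List.filter_cons]
    by_cases h : f k = []
    · simp [h]
    · simp [h, counit_single h]

@[simp] theorem cutTensor_vertex (c : Fin (n + 1)) :
    cutTensor (PT.vertex c) = (δ []) ⊗ₜ ((δ []) ⊗ₜ (δ (PT.vertex c))) := by
  simp [cutTensor, leftCuts]

/-- The forest cut off at the root needs its own tensor factor: cutting the new edge concatenates
`σ` in front of it, whereas the other pruned forests are only shuffled. -/
theorem cutTensor_graft (σ τ : PT n) :
    cutTensor (PT.graft σ τ) =
      LinearMap.rTensor _ (cat (δ [σ])) (cutTensor τ) +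
        (δ []) ⊗ₜ shuffleGraft (cutCoaction (δ σ)) (rootUncut τ) := by
  rw [rootUncut, cutCoaction_single, shuffleLeft_cutTensor, cutTensor, leftCuts, List.map_append,
    List.sum_append]
  congr 1
  · simp [cutTensor, map_list_sum, List.map_map, Function.comp_def]
  · rw [cutTensor, evalLeft_counit_sum, bilinear_sum_sum, ← TensorProduct.mk_apply,
      map_list_sum, sum_map_flatMap]
    simp [map_list_sum, List.map_map, Function.comp_def, shuffleAllL_append, shuffle_assoc]

theorem rootUncut_vertex (c : Fin (n + 1)) :
    rootUncut (PT.vertex c) = (δ []) ⊗ₜ (δ (PT.vertex c)) := by simp [rootUncut]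

theorem rootUncut_graft (σ τ : PT n) :
    rootUncut (PT.graft σ τ) = shuffleGraft (cutCoaction (δ σ)) (rootUncut τ) := by
  rw [rootUncut, cutTensor_graft, map_add, evalLeft_rTensor]
  have : counit ∘ₗ cat (δ [σ]) = 0 := by
    ext x; simp [counit]
  rw [this]
  simp [evalLeft]

theorem mkw_single (ω : List (PT n)) :
    mkw (δ ω) = LinearMap.lTensor (OF n) branchesL (cutCoaction (δ (PT.bPlus 0 ω))) := by
  rw [cutCoaction_single, shuffleLeft_cutTensor, mkw]
  simp only [Finsupp.lift_apply, zero_smul, Finsupp.sum_single_index, one_smul, map_list_sum,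
    List.map_map, Function.comp_def]
  congr 1
  refine List.map_congr_left fun k _ => ?_
  rw [LinearMap.lTensor_tmul, branchesL_single, shuffleAllL]
  induction shuffleAll (k.atRoot :: k.above) with
  | nil => simp
  | cons u L ih => simp [ih, TensorProduct.add_tmul]

/-- Cuts do not see the decoration of the root, so the coproduct, defined with root decoration `0`,
governs the cuts of every tree. -/
theorem cutTensor_bPlus (c : Fin (n + 1)) (ω : List (PT n)) :
    cutTensor (PT.bPlus c ω) =
      LinearMap.lTensor _ (LinearMap.lTensor _ (bPlusL c ∘ₗ branchesL))
        (cutTensor (PT.bPlus 0 ω)) := by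
  induction ω with
  | nil => simp [PT.bPlus, PT.branches]
  | cons t ω ih =>
    change cutTensor (PT.graft t (PT.bPlus c ω)) =
      LinearMap.lTensor _ (LinearMap.lTensor _ (bPlusL c ∘ₗ branchesL))
        (cutTensor (PT.graft t (PT.bPlus 0 ω)))
    have key : ∀ x y : OF n ⊗[ℝ] TS n,
        shuffleGraft x (LinearMap.lTensor _ (bPlusL c ∘ₗ branchesL) y) =
          LinearMap.lTensor _ (bPlusL c ∘ₗ branchesL) (shuffleGraft x y) := by
      intro x y
      induction x with
      | zero => simp
      | add a b ha hb => simp only [map_add, LinearMap.add_apply, ha, hb]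
      | tmul x₁ x₂ =>
        induction y with
        | zero => simp
        | add a b ha hb => simp only [map_add, ha, hb]
        | tmul y₁ y₂ => simp [branchesL_graftL, bPlusL_cat_letter]
    rw [cutTensor_graft, cutTensor_graft, rootUncut, ih, evalLeft_lTensor, key, map_add,
      LinearMap.lTensor_tmul, ← rootUncut]
    congr 1
    rw [← LinearMap.comp_apply, ← LinearMap.comp_apply, LinearMap.rTensor_comp_lTensor,
      LinearMap.lTensor_comp_rTensor]

theorem cutCoaction_bPlusL (c : Fin (n + 1)) (x : OF n) :
    cutCoaction (bPlusL c x) = LinearMap.lTensor (OF n) (bPlusL c) (mkw x) := by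
  refine linearMap_apply_eq_of_basis (f := cutCoaction ∘ₗ bPlusL c)
    (g := LinearMap.lTensor (OF n) (bPlusL c) ∘ₗ mkw) (fun ω => ?_) x
  simp only [LinearMap.comp_apply, bPlusL_single]
  rw [mkw_single, cutCoaction_single, cutTensor_bPlus, ← lTensor_shuffleLeft, ← cutCoaction_single,
    LinearMap.lTensor_comp, LinearMap.comp_apply]

/-! ## The recursion of the coproduct from the right -/

/-- The part of the coproduct in which no tree of the forest is cut off entirely. -/
noncomputable def wordUncut (ω : List (PT n)) : OF n ⊗[ℝ] OF n :=
  LinearMap.lTensor (OF n) branchesL (rootUncut (PT.bPlus 0 ω))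

/-- The coaction on trees, with the trunk seen as a forest. -/
noncomputable def letterCoaction : TS n →ₗ[ℝ] OF n ⊗[ℝ] OF n :=
  LinearMap.lTensor (OF n) letter ∘ₗ cutCoaction

theorem wordUncut_nil : wordUncut ([] : List (PT n)) = (δ []) ⊗ₜ (δ []) := by
  simp [wordUncut, PT.bPlus, rootUncut_vertex, PT.branches]

theorem wordUncut_cons (t : PT n) (ω : List (PT n)) :
    wordUncut (t :: ω) = shuffleCat (letterCoaction (δ t)) (wordUncut ω) := by
  change LinearMap.lTensor (OF n) branchesL (rootUncut (PT.graft t (PT.bPlus 0 ω))) = _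
  rw [rootUncut_graft, lTensor_branchesL_shuffleGraft]
  rfl

/-- Without cuts at the root the contributions of the trees multiply associatively, so left and
right recursions agree. -/
theorem wordUncut_concat (ω : List (PT n)) (t : PT n) :
    wordUncut (ω ++ [t]) = shuffleCat (wordUncut ω) (letterCoaction (δ t)) := by
  induction ω with
  | nil => rw [List.nil_append, wordUncut_cons, wordUncut_nil, shuffleCat_one_right,
      shuffleCat_one_left]
  | cons s ω ih => rw [List.cons_append, wordUncut_cons, ih, wordUncut_cons, shuffleCat_assoc]

/-- The coproduct of `ω`, with the word `v` put in front of the forest cut off from the root. -/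
noncomputable def mkwPrefix (v ω : List (PT n)) : OF n ⊗[ℝ] OF n :=
  LinearMap.lTensor (OF n) branchesL (shuffleLeft (TS n)
    (LinearMap.rTensor _ (cat (δ v)) (cutTensor (PT.bPlus 0 ω))))

theorem mkwPrefix_nil_left (ω : List (PT n)) : mkwPrefix [] ω = mkw (δ ω) := by
  have : cat (δ ([] : List (PT n))) = LinearMap.id := by ext1 x; ext1; simp
  rw [mkwPrefix, this, LinearMap.rTensor_id, mkw_single, cutCoaction_single]
  rfl

theorem mkwPrefix_nil_right (v : List (PT n)) : mkwPrefix v [] = (δ v) ⊗ₜ (δ []) := by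
  simp [mkwPrefix, PT.bPlus, PT.branches]

theorem shuffleCat_one_tmul (x : OF n) (z : OF n ⊗[ℝ] OF n) :
    shuffleCat (x ⊗ₜ (δ [])) z = shuffleLeft (OF n) (x ⊗ₜ z) := by
  induction z with
  | zero => simp
  | add a b ha hb => simp only [TensorProduct.tmul_add, map_add, ha, hb]
  | tmul y v => simp

/-- Either `t` is cut off and joins the prefix, or it stays, and then no later edge at the root may
be cut. -/
theorem mkwPrefix_cons (v : List (PT n)) (t : PT n) (ω : List (PT n)) :
    mkwPrefix v (t :: ω) = mkwPrefix (v ++ [t]) ω +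
      shuffleCat ((δ v) ⊗ₜ (δ [])) (wordUncut (t :: ω)) := by
  rw [mkwPrefix]
  change LinearMap.lTensor (OF n) branchesL (shuffleLeft (TS n) (LinearMap.rTensor _ (cat (δ v))
    (cutTensor (PT.graft t (PT.bPlus 0 ω))))) = _
  rw [cutTensor_graft, map_add, map_add, map_add]
  congr 1
  · rw [mkwPrefix, ← LinearMap.comp_apply (LinearMap.rTensor _ _), ← LinearMap.rTensor_comp]
    congr 4
    ext1 x; ext1; simp
  · rw [LinearMap.rTensor_tmul, cat_one_right, lTensor_shuffleLeft, LinearMap.lTensor_tmul,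
      lTensor_branchesL_shuffleGraft, shuffleCat_one_tmul, wordUncut_cons]
    rfl

/-- A cut through the last edge at the root cuts all edges there and gives the isolated term;
otherwise the last tree contributes its own coaction. An arbitrary prefix is needed because the
recursion from the left lengthens it. -/
theorem mkwPrefix_concat (v ω : List (PT n)) (t : PT n) :
    mkwPrefix v (ω ++ [t]) = shuffleCat (mkwPrefix v ω) (letterCoaction (δ t)) +
      (δ (v ++ ω ++ [t])) ⊗ₜ (δ []) := by
  induction ω generalizing v with
  | nil =>
    rw [List.nil_append, mkwPrefix_cons, mkwPrefix_nil_right, mkwPrefix_nil_right,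
      wordUncut_cons, wordUncut_nil, shuffleCat_one_right, List.append_nil, add_comm]
  | cons s ω ih =>
    rw [List.cons_append, mkwPrefix_cons, ih, mkwPrefix_cons, ← List.cons_append,
      wordUncut_concat, ← shuffleCat_assoc, map_add, LinearMap.add_apply]
    simp only [List.append_assoc, List.cons_append, List.nil_append]
    abel

@[simp] theorem mkw_one : mkw (δ ([] : List (PT n))) = (δ []) ⊗ₜ (δ []) := by
  rw [← mkwPrefix_nil_left, mkwPrefix_nil_right]

theorem mkw_concat (ω : List (PT n)) (t : PT n) :
    mkw (δ (ω ++ [t])) = shuffleCat (mkw (δ ω)) (letterCoaction (δ t)) +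
      (δ (ω ++ [t])) ⊗ₜ (δ []) := by
  rw [← mkwPrefix_nil_left, mkwPrefix_concat, mkwPrefix_nil_left, List.nil_append]

theorem mkw_cat_letter (x : OF n) (a : TS n) :
    mkw (cat x (letter a)) = shuffleCat (mkw x) (letterCoaction a) +
      cat x (letter a) ⊗ₜ (δ []) := by
  induction x using basis_induction with
  | zero => simp
  | add x y hx hy => simp only [map_add, LinearMap.add_apply, hx, hy, TensorProduct.add_tmul]; abel
  | smul r x hx =>
    simp only [map_smul, LinearMap.smul_apply, hx, smul_add, ← TensorProduct.smul_tmul']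
  | basis u =>
    induction a using basis_induction with
    | zero => simp
    | add x y hx hy =>
      simp only [map_add, hx, hy, TensorProduct.add_tmul]; abel
    | smul r x hx =>
      simp only [map_smul, hx, smul_add, ← TensorProduct.smul_tmul']
    | basis a => rw [letter_single, cat_single, mkw_concat]

/-! ## Grading by the number of vertices -/

theorem PT.size_pos (τ : PT n) : 0 < τ.size := by
  induction τ with
  | vertex c => simp [PT.size]
  | graft σ τ h _ => simp only [PT.size]; omega

theorem PT.forestSize_branches (τ : PT n) : forestSize τ.branches + 1 = τ.size := by
  induction τ with
  | vertex c => simp [PT.size, PT.branches, forestSize]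
  | graft σ τ _ h =>
    simp only [PT.size, PT.branches, forestSize, List.map_cons, List.sum_cons] at h ⊢
    omega

theorem PT.size_bPlus (c : Fin (n + 1)) (ω : List (PT n)) :
    (PT.bPlus c ω).size = forestSize ω + 1 := by
  rw [← PT.forestSize_branches, PT.branches_bPlus]

@[simp] theorem forestSize_nil : forestSize ([] : List (PT n)) = 0 := rfl

@[simp] theorem forestSize_cons (t : PT n) (ω : List (PT n)) :
    forestSize (t :: ω) = t.size + forestSize ω := by simp [forestSize]

@[simp] theorem forestSize_append (u v : List (PT n)) :
    forestSize (u ++ v) = forestSize u + forestSize v := by simp [forestSize]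

theorem forestSize_eq_zero {ω : List (PT n)} (h : forestSize ω = 0) : ω = [] := by
  cases ω with
  | nil => rfl
  | cons t ω => have := t.size_pos; simp at h; omega

theorem forestSize_of_mem_shuffles : ∀ (v w : List (PT n)), ∀ u ∈ shuffles v w,
    forestSize u = forestSize v + forestSize w
  | [], w, u, h => by simp [shuffles_nil_left] at h; simp [h]
  | a :: v, [], u, h => by simp [shuffles_nil_right] at h; simp [h]
  | a :: v, b :: w, u, h => by
    rw [shuffles, List.mem_append, List.mem_map, List.mem_map] at h
    rcases h with ⟨x, hx, rfl⟩ | ⟨x, hx, rfl⟩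
    · have := forestSize_of_mem_shuffles v (b :: w) x hx
      simp at this ⊢; omega
    · have := forestSize_of_mem_shuffles (a :: v) w x hx
      simp at this ⊢; omega
termination_by v w => v.length + w.length

theorem forestSize_of_mem_shuffleAll (ws : List (List (PT n))) : ∀ u ∈ shuffleAll ws,
    forestSize u = (ws.map forestSize).sum := by
  induction ws with
  | nil => intro u hu; simp [shuffleAll] at hu; simp [hu]
  | cons w ws ih =>
    intro u hu
    rw [shuffleAll, List.mem_flatMap] at hu
    obtain ⟨x, hx, hu⟩ := hu
    rw [forestSize_of_mem_shuffles _ _ _ hu, ih x hx, List.map_cons, List.sum_cons]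

theorem size_of_mem_leftCuts (τ : PT n) : ∀ k ∈ leftCuts τ,
    forestSize k.atRoot + (k.above.map forestSize).sum + k.trunk.size = τ.size := by
  induction τ with
  | vertex c => intro k hk; simp [leftCuts] at hk; simp [hk]
  | graft σ τ ihσ ihτ =>
    intro k hk
    rw [leftCuts, List.mem_append, List.mem_map, List.mem_flatMap] at hk
    rcases hk with ⟨l, hl, rfl⟩ | ⟨l, hl, hk⟩
    · have := ihτ l hl
      simp only [forestSize_cons, PT.size]
      omega
    · rw [List.mem_map] at hk
      obtain ⟨m, hm, rfl⟩ := hk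
      rw [List.mem_filter, List.isEmpty_iff] at hm
      have h1 := ihσ l hl
      have h2 := ihτ m hm.1
      rw [hm.2] at h2
      simp only [forestSize_nil, List.map_cons, List.map_append, List.sum_cons, List.sum_append,
        PT.size] at h2 ⊢
      omega

/-- Homogeneity of the coproduct, in the form used by the inductions on size. -/
theorem mkw_mem_span (ω : List (PT n)) :
    mkw (δ ω) ∈ Submodule.span ℝ {z : OF n ⊗[ℝ] OF n | ∃ u v : List (PT n),
      forestSize u + forestSize v = forestSize ω ∧ z = (δ u) ⊗ₜ[ℝ] (δ v)} := by
  rw [mkw]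
  simp only [Finsupp.lift_apply, zero_smul, Finsupp.sum_single_index, one_smul]
  refine list_sum_mem fun x hx => ?_
  obtain ⟨k, hk, rfl⟩ := List.mem_map.mp hx
  refine list_sum_mem fun x hx => ?_
  obtain ⟨u, hu, rfl⟩ := List.mem_map.mp hx
  refine Submodule.subset_span ⟨_, _, ?_, rfl⟩
  have h1 := size_of_mem_leftCuts _ k hk
  have h2 := forestSize_of_mem_shuffleAll _ u hu
  have h3 := PT.forestSize_branches k.trunk
  rw [PT.size_bPlus] at h1
  rw [List.map_cons, List.sum_cons] at h2
  omega

/-- Induction on forests by the trees at the right. -/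
theorem forest_induction {p : List (PT n) → Prop} (nil : p [])
    (concat : ∀ u c w, p u → p w → p (u ++ [PT.bPlus c w])) (ω : List (PT n)) : p ω := by
  induction h : forestSize ω using Nat.strong_induction_on generalizing ω with
  | _ N ih =>
    rcases List.eq_nil_or_concat' ω with rfl | ⟨u, t, rfl⟩
    · exact nil
    · rw [← PT.bPlus_root_branches t]
      have h1 := PT.forestSize_branches t
      simp only [forestSize_append, forestSize_cons, forestSize_nil] at h
      exact concat _ _ _ (ih _ (by omega) _ rfl) (ih _ (by omega) _ rfl)

/-! ## The action of the characters -/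

/-- Characters of the shuffle algebra of the forests. -/
def IsShuffleCharacter (g : OF n →ₗ[ℝ] ℝ) : Prop :=
  g (δ []) = 1 ∧ ∀ x y, g (shuffle x y) = g x * g y

/-- The operator `(g ⊗ id) Δ_MKW`. -/
noncomputable def forestAction (g : OF n →ₗ[ℝ] ℝ) : OF n →ₗ[ℝ] OF n := evalLeft _ g ∘ₗ mkw

/-- The operator `(g ⊗ id)` after the coaction on trees. -/
noncomputable def treeAction (g : OF n →ₗ[ℝ] ℝ) : TS n →ₗ[ℝ] TS n :=
  evalLeft _ g ∘ₗ cutCoaction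

/-- Turns Chen's relation into a composition rule for the operators `forestAction`. -/
theorem conv_eq_comp (f g : OF n →ₗ[ℝ] ℝ) : conv f g = g ∘ₗ forestAction f := by
  refine LinearMap.ext fun x => ?_
  simp only [conv, forestAction, LinearMap.comp_apply]
  induction mkw x with
  | zero => simp
  | add a b ha hb => simp only [map_add, ha, hb]
  | tmul a b => simp

theorem treeAction_bPlusL (g : OF n →ₗ[ℝ] ℝ) (c : Fin (n + 1)) (x : OF n) :
    treeAction g (bPlusL c x) = bPlusL c (forestAction g x) := by
  rw [treeAction, LinearMap.comp_apply, cutCoaction_bPlusL, evalLeft_lTensor]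
  rfl

theorem evalLeft_letterCoaction (g : OF n →ₗ[ℝ] ℝ) (a : TS n) :
    evalLeft _ g (letterCoaction a) = letter (treeAction g a) := by
  rw [letterCoaction, LinearMap.comp_apply, evalLeft_lTensor]
  rfl

section

variable {g : OF n →ₗ[ℝ] ℝ} (hg : IsShuffleCharacter g)

include hg

theorem IsShuffleCharacter.evalLeft_shuffleCat (x y : OF n ⊗[ℝ] OF n) :
    evalLeft _ g (shuffleCat x y) = cat (evalLeft _ g x) (evalLeft _ g y) := by
  induction x with
  | zero => simp
  | add a b ha hb => simp only [map_add, LinearMap.add_apply, ha, hb]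
  | tmul x₁ x₂ =>
    induction y with
    | zero => simp
    | add a b ha hb => simp only [map_add, ha, hb]
    | tmul y₁ y₂ => simp [hg.2, smul_smul, mul_comm]

theorem IsShuffleCharacter.forestAction_one : forestAction g (δ []) = δ [] := by
  simp [forestAction, hg.1]

theorem IsShuffleCharacter.forestAction_cat_letter (x : OF n) (a : TS n) :
    forestAction g (cat x (letter a)) =
      cat (forestAction g x) (letter (treeAction g a)) + g (cat x (letter a)) • δ [] := by
  rw [forestAction, LinearMap.comp_apply, mkw_cat_letter, map_add, hg.evalLeft_shuffleCat,
    evalLeft_letterCoaction, evalLeft_tmul]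
  rfl

theorem IsShuffleCharacter.forestAction_concat (ω : List (PT n)) (t : PT n) :
    forestAction g (δ (ω ++ [t])) =
      cat (forestAction g (δ ω)) (letter (treeAction g (δ t))) + g (δ (ω ++ [t])) • δ [] := by
  rw [← cat_single, ← letter_single, hg.forestAction_cat_letter]

/-- This is the compatibility of the coproduct with the shuffle, with the left factor already
evaluated. Both sides are expanded in their last letters. -/
theorem IsShuffleCharacter.forestAction_shuffle (x y : OF n) :
    forestAction g (shuffle x y) = shuffle (forestAction g x) (forestAction g y) := by
  induction x using basis_induction with
  | zero => simp
  | add a b ha hb => simp [ha, hb]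
  | smul r a ha => simp [ha]
  | basis u =>
    induction y using basis_induction with
    | zero => simp
    | add a b ha hb => simp only [map_add, ha, hb]
    | smul r a ha => simp only [map_smul, ha]
    | basis v =>
      induction u using List.reverseRecOn generalizing v with
      | nil => simp [hg.forestAction_one]
      | append_singleton u a ihu =>
        induction v using List.reverseRecOn with
        | nil => simp [hg.forestAction_one]
        | append_singleton v b ihv =>
          -- Multiplicativity of `g` on the full words matches the coefficients of the empty word.
          have h := hg.2 (δ (u ++ [a])) (δ (v ++ [b]))
          rw [shuffle_concat_concat, map_add, ← letter_single a, ← letter_single b] at h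
          rw [shuffle_concat_concat, map_add, ← letter_single a, ← letter_single b,
            hg.forestAction_cat_letter, hg.forestAction_cat_letter, ihu, ihv,
            hg.forestAction_concat, hg.forestAction_concat, add_add_add_comm, ← add_smul, h]
          simp only [map_add, LinearMap.add_apply, map_smul, LinearMap.smul_apply,
            shuffle_one_left, shuffle_one_right, shuffle_cat_letter, smul_add, smul_smul]
          rw [mul_comm (g (δ (v ++ [b])))]
          abel

omit hg in
theorem rTensor_lTensor_apply {V W : Type*} [AddCommMonoid V] [Module ℝ V] [AddCommMonoid W]
    [Module ℝ W] (f : OF n →ₗ[ℝ] OF n) (k : V →ₗ[ℝ] W) (z : OF n ⊗[ℝ] V) :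
    LinearMap.rTensor W f (LinearMap.lTensor (OF n) k z) =
      LinearMap.lTensor (OF n) k (LinearMap.rTensor V f z) := by
  rw [← LinearMap.comp_apply, ← LinearMap.comp_apply, LinearMap.rTensor_comp_lTensor,
    LinearMap.lTensor_comp_rTensor]

theorem IsShuffleCharacter.rTensor_shuffleCat (x y : OF n ⊗[ℝ] OF n) :
    LinearMap.rTensor _ (forestAction g) (shuffleCat x y) =
      shuffleCat (LinearMap.rTensor _ (forestAction g) x)
        (LinearMap.rTensor _ (forestAction g) y) := by
  induction x with
  | zero => simp
  | add a b ha hb => simp only [map_add, LinearMap.add_apply, ha, hb]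
  | tmul x₁ x₂ =>
    induction y with
    | zero => simp
    | add a b ha hb => simp only [map_add, ha, hb]
    | tmul y₁ y₂ => simp [hg.forestAction_shuffle]

/-- Coassociativity, evaluated on a character. -/
theorem IsShuffleCharacter.mkw_forestAction (x : OF n) :
    mkw (forestAction g x) = LinearMap.rTensor _ (forestAction g) (mkw x) := by
  refine linearMap_apply_eq_of_basis (f := mkw ∘ₗ forestAction g)
    (g := LinearMap.rTensor _ (forestAction g) ∘ₗ mkw) (fun ω => ?_) x
  simp only [LinearMap.comp_apply]
  induction ω using forest_induction with
  | nil => simp [hg.forestAction_one]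
  | concat u c w hu hw =>
    -- Coassociativity for the last tree reduces to coassociativity for its branches.
    have h : letterCoaction (treeAction g (δ (PT.bPlus c w))) =
        LinearMap.rTensor _ (forestAction g) (letterCoaction (δ (PT.bPlus c w))) := by
      rw [letterCoaction, LinearMap.comp_apply, LinearMap.comp_apply, ← bPlusL_single,
        treeAction_bPlusL, cutCoaction_bPlusL, cutCoaction_bPlusL, hw]
      rw [rTensor_lTensor_apply, rTensor_lTensor_apply]
    rw [hg.forestAction_concat, map_add, mkw_cat_letter, hu, h, mkw_concat, map_add,
      hg.rTensor_shuffleCat, LinearMap.rTensor_tmul, hg.forestAction_concat, map_smul, mkw_one,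
      TensorProduct.add_tmul, TensorProduct.smul_tmul', add_assoc]

theorem IsShuffleCharacter.forestAction_forestAction (f : OF n →ₗ[ℝ] ℝ) (x : OF n) :
    forestAction f (forestAction g x) = forestAction (f ∘ₗ forestAction g) x := by
  rw [forestAction, LinearMap.comp_apply, hg.mkw_forestAction, evalLeft_rTensor]
  rfl

theorem IsShuffleCharacter.treeAction_treeAction (f : OF n →ₗ[ℝ] ℝ) (a : TS n) :
    treeAction f (treeAction g a) = treeAction (f ∘ₗ forestAction g) a := by
  refine linearMap_apply_eq_of_basis (f := treeAction f ∘ₗ treeAction g)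
    (g := treeAction (f ∘ₗ forestAction g)) (fun t => ?_) a
  rw [LinearMap.comp_apply, ← PT.bPlus_root_branches t, ← bPlusL_single, treeAction_bPlusL,
    treeAction_bPlusL, treeAction_bPlusL, hg.forestAction_forestAction]

/-- The coefficient of the empty word recovers `g`, since an empty trunk forest means that
everything is cut off. -/
theorem IsShuffleCharacter.counit_forestAction (x : OF n) : counit (forestAction g x) = g x := by
  refine linearMap_apply_eq_of_basis (f := counit ∘ₗ forestAction g) (g := g) (fun ω => ?_) x
  rw [LinearMap.comp_apply]
  induction ω using List.reverseRecOn with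
  | nil => rw [hg.forestAction_one, counit_one, hg.1]
  | append_singleton u t _ =>
    rw [hg.forestAction_concat, map_add, counit_cat_letter_right, map_smul, counit_one, zero_add,
      smul_eq_mul, mul_one]

end

theorem counit_isShuffleCharacter : IsShuffleCharacter (counit : OF n →ₗ[ℝ] ℝ) := by
  refine ⟨counit_one, fun x y => ?_⟩
  induction x using basis_induction with
  | zero => simp
  | add a b ha hb => simp [ha, hb, add_mul]
  | smul r a ha => simp [ha, mul_assoc]
  | basis u =>
    induction y using basis_induction with
    | zero => simp
    | add a b ha hb => simp only [map_add, ha, hb, mul_add]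
    | smul r a ha => simp only [map_smul, ha, smul_eq_mul]; ring
    | basis v =>
      cases u with
      | nil => simp
      | cons a u =>
        cases v with
        | nil => simp
        | cons b v =>
          rw [shuffle_cons_cons, map_add, ← letter_single a, ← letter_single b,
            counit_cat_letter_left, counit_cat_letter_left, counit_single (by simp)]
          simp

theorem forestAction_counit (x : OF n) : forestAction counit x = x := by
  refine linearMap_apply_eq_of_basis (f := forestAction counit) (g := LinearMap.id)
    (fun ω => ?_) x
  induction ω using forest_induction with
  | nil => exact counit_isShuffleCharacter.forestAction_one
  | concat u c w hu hw =>
    rw [counit_isShuffleCharacter.forestAction_concat, hu, ← bPlusL_single, treeAction_bPlusL, hw,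
      counit_single (by simp)]
    simp

theorem treeAction_counit (a : TS n) : treeAction counit a = a := by
  refine linearMap_apply_eq_of_basis (f := treeAction counit) (g := LinearMap.id)
    (fun t => ?_) a
  rw [← PT.bPlus_root_branches t, ← bPlusL_single, treeAction_bPlusL, forestAction_counit]
  rfl

/-- By induction on size: in a term `u ⊗ v` of the coproduct with `v` nonempty, `u` is smaller than
`ω`, so `f` already agrees there with the counit. Only the terms `u ⊗ 1` remain, and idempotence
forces their contribution to vanish. -/
theorem IsShuffleCharacter.eq_counit_of_idempotent {f : OF n →ₗ[ℝ] ℝ}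
    (hf : IsShuffleCharacter f) (h : conv f f = f) : f = counit := by
  refine linearMap_ext_basis fun ω => ?_
  induction hN : forestSize ω using Nat.strong_induction_on generalizing ω with
  | _ N ih =>
    have key : ∃ c : ℝ, forestAction f (δ ω) = forestAction counit (δ ω) + c • δ [] := by
      rw [forestAction, forestAction, LinearMap.comp_apply, LinearMap.comp_apply]
      refine Submodule.span_induction (p := fun z _ => ∃ c : ℝ,
        evalLeft _ f z = evalLeft _ counit z + c • δ []) ?_ ⟨0, by simp⟩ ?_ ?_ (mkw_mem_span ω)
      · rintro _ ⟨u, v, huv, rfl⟩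
        by_cases hv : v = []
        · subst hv
          refine ⟨f (δ u) - counit (δ u), ?_⟩
          rw [evalLeft_tmul, evalLeft_tmul, ← add_smul]
          congr 1; ring
        · refine ⟨0, ?_⟩
          have : forestSize v ≠ 0 := fun h => hv (forestSize_eq_zero h)
          rw [evalLeft_tmul, evalLeft_tmul, ih _ (by omega) u rfl, zero_smul, add_zero]
      · rintro x y - - ⟨a, ha⟩ ⟨b, hb⟩
        refine ⟨a + b, ?_⟩
        rw [map_add, ha, hb, map_add, add_smul]; abel
      · rintro r x - ⟨a, ha⟩
        exact ⟨r * a, by rw [map_smul, ha, map_smul, smul_add, smul_smul]⟩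
    obtain ⟨c, hc⟩ := key
    rw [forestAction_counit] at hc
    -- Now `(f ⊗ id) Δ ω = ω + c • 1`. Applying `f` gives `f(ω) + c = f(ω)`, hence `c = 0`, and
    -- applying the counit then gives the claim.
    have h1 := hf.counit_forestAction (δ ω)
    have h2 := LinearMap.congr_fun h (δ ω)
    rw [conv_eq_comp, LinearMap.comp_apply, hc, map_add, map_smul, hf.1, smul_eq_mul] at h2
    rw [hc, map_add, map_smul, counit_one, smul_eq_mul] at h1
    linarith

/-! ## Maps of trees that commute with the action of the characters -/

theorem IsShuffleCharacter.comp_letterwise {g : OF n →ₗ[ℝ] ℝ} (hg : IsShuffleCharacter g)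
    (A : TS n →ₗ[ℝ] TS n) : IsShuffleCharacter (g ∘ₗ letterwise A) := by
  refine ⟨by simp [hg.1], fun x y => ?_⟩
  simp only [LinearMap.comp_apply, letterwise_shuffle, hg.2]

/-- The operator `(id ⊗ f) Δ_MKW`. -/
noncomputable def rightAction (f : OF n →ₗ[ℝ] ℝ) : OF n →ₗ[ℝ] OF n := evalRight f ∘ₗ mkw

theorem rightAction_mem_span (f : OF n →ₗ[ℝ] ℝ) (ω : List (PT n)) :
    rightAction f (δ ω) ∈
      Submodule.span ℝ {x : OF n | ∃ u, forestSize u ≤ forestSize ω ∧ x = δ u} := by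
  rw [rightAction, LinearMap.comp_apply]
  refine Submodule.span_induction (p := fun z _ => evalRight f z ∈
      Submodule.span ℝ {x : OF n | ∃ u, forestSize u ≤ forestSize ω ∧ x = δ u}) ?_ ?_ ?_ ?_
      (mkw_mem_span ω)
  · rintro _ ⟨u, v, huv, rfl⟩
    rw [evalRight_tmul]
    exact Submodule.smul_mem _ _ (Submodule.subset_span ⟨u, by omega, rfl⟩)
  · simp
  · intro x y _ _ hx hy
    rw [map_add]; exact Submodule.add_mem _ hx hy
  · intro r x _ hx
    rw [map_smul]; exact Submodule.smul_mem _ _ hx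

/-- By coassociativity the two operators act at opposite ends of the iterated coproduct and
therefore commute. -/
theorem IsShuffleCharacter.rightAction_forestAction {g : OF n →ₗ[ℝ] ℝ}
    (hg : IsShuffleCharacter g) (f : OF n →ₗ[ℝ] ℝ) (x : OF n) :
    rightAction f (forestAction g x) = forestAction g (rightAction f x) := by
  rw [rightAction, LinearMap.comp_apply, LinearMap.comp_apply, hg.mkw_forestAction,
    evalRight_rTensor]

section

variable {A : TS n →ₗ[ℝ] TS n} {f : Fin (n + 1) → OF n →ₗ[ℝ] ℝ}
  (hA : ∀ c x, A (bPlusL c x) =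
    bPlusL c (letterwise A x) + bPlusL 0 (letterwise A (rightAction (f c) x)))
  {g : OF n →ₗ[ℝ] ℝ} (hg : IsShuffleCharacter g)

include hA hg

/-- The cointeraction of cutting and contracting. Stripping the last tree `t` reduces it to the
analogue for `t`; there `hA` leaves only forests no larger than the branches of `t`, to which the
induction hypothesis applies. -/
theorem forestAction_letterwise (x : OF n) :
    forestAction g (letterwise A x) = letterwise A (forestAction (g ∘ₗ letterwise A) x) := by
  have hgA := hg.comp_letterwise A
  refine linearMap_apply_eq_of_basis (f := forestAction g ∘ₗ letterwise A)
    (g := letterwise A ∘ₗ forestAction (g ∘ₗ letterwise A)) (fun ω => ?_) x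
  induction hN : forestSize ω using Nat.strong_induction_on generalizing ω with
  | _ N ih =>
    rcases List.eq_nil_or_concat' ω with rfl | ⟨u, t, rfl⟩
    · simp [hg.forestAction_one, hgA.forestAction_one]
    · have h1 := PT.forestSize_branches t
      simp only [forestSize_append, forestSize_cons, forestSize_nil] at hN
      have hu := ih _ (by omega) u rfl
      have ht : treeAction g (A (δ t)) = A (treeAction (g ∘ₗ letterwise A) (δ t)) := by
        rw [← PT.bPlus_root_branches t, ← bPlusL_single, hA, map_add, treeAction_bPlusL,
          treeAction_bPlusL, treeAction_bPlusL, hA]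
        have h2 := ih _ (by omega) t.branches rfl
        -- `rightAction` yields a combination of forests rather than a single one, so the induction
        -- hypothesis is extended to their span.
        have h3 : (forestAction g ∘ₗ letterwise A) (rightAction (f t.root) (δ t.branches)) =
            (letterwise A ∘ₗ forestAction (g ∘ₗ letterwise A))
              (rightAction (f t.root) (δ t.branches)) := by
          refine LinearMap.eqOn_span ?_ (rightAction_mem_span _ _)
          rintro _ ⟨v, hv, rfl⟩
          exact ih _ (by omega) v rfl
        simp only [LinearMap.comp_apply] at h2 h3
        rw [h2, h3, hgA.rightAction_forestAction]
      simp only [LinearMap.comp_apply] at hu ⊢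
      rw [letterwise_concat, hg.forestAction_cat_letter, hu, ht, hgA.forestAction_concat, map_add,
        map_smul, letterwise_cat, letterwise_letter, letterwise_one, LinearMap.comp_apply,
        letterwise_concat]

theorem treeAction_comm (a : TS n) :
    treeAction g (A a) = A (treeAction (g ∘ₗ letterwise A) a) := by
  refine linearMap_apply_eq_of_basis (f := treeAction g ∘ₗ A)
    (g := A ∘ₗ treeAction (g ∘ₗ letterwise A)) (fun t => ?_) a
  rw [LinearMap.comp_apply, LinearMap.comp_apply, ← PT.bPlus_root_branches t, ← bPlusL_single,
    hA, map_add, treeAction_bPlusL, treeAction_bPlusL, treeAction_bPlusL, hA,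
    (hg.comp_letterwise A).rightAction_forestAction, forestAction_letterwise hA hg,
    forestAction_letterwise hA hg]

end

/-! ## Contraction of weighted blocks -/

section

variable (w : PT n → ℝ)

/-- The sum of the contractions of a list of partitions, weighted by their blocks. -/
noncomputable def weightedSum (L : List (List (PT n) × PT n)) : TS n :=
  (L.map fun p => (p.1.map w).prod • δ p.2).sum

/-- The sum of the contractions of a tree over all its admissible partitions, weighted by the
blocks. -/
noncomputable def contraction : TS n →ₗ[ℝ] TS n :=
  Finsupp.lift _ ℝ _ fun τ => weightedSum w (partitions τ)

theorem contraction_single (τ : PT n) : contraction w (δ τ) = weightedSum w (partitions τ) := by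
  simp [contraction]

/-- The analogue of `cutTensor` for the partitions with a block that contains the root. -/
noncomputable def coveredTensor (τ : PT n) : OF n ⊗[ℝ] (OF n ⊗[ℝ] TS n) :=
  ((covered τ).map fun k => (δ k.atRoot) ⊗ₜ[ℝ]
    ((k.extracted.map w).prod • shuffleAllL k.above ⊗ₜ[ℝ] (δ k.block))).sum

@[simp] theorem coveredTensor_vertex (c : Fin (n + 1)) :
    coveredTensor w (PT.vertex c) = (δ []) ⊗ₜ ((δ []) ⊗ₜ (δ (PT.vertex c))) := by
  simp [coveredTensor, covered]

theorem shuffleLeft_coveredTensor (τ : PT n) : shuffleLeft (TS n) (coveredTensor w τ) =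
    ((covered τ).map fun k => (k.extracted.map w).prod •
      shuffleAllL (k.atRoot :: k.above) ⊗ₜ[ℝ] (δ k.block)).sum := by
  simp [coveredTensor, map_list_sum, List.map_map, Function.comp_def]

theorem coveredTensor_graft (σ τ : PT n) :
    coveredTensor w (PT.graft σ τ) =
      LinearMap.rTensor _ (cat (letter (contraction w (δ σ)))) (coveredTensor w τ) +
        (δ []) ⊗ₜ shuffleGraft (shuffleLeft _ (coveredTensor w σ))
          (evalLeft _ counit (coveredTensor w τ)) := by
  rw [shuffleLeft_coveredTensor, coveredTensor, covered, List.map_append, List.sum_append]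
  congr 1
  · rw [sum_map_flatMap, contraction_single, weightedSum, coveredTensor]
    -- The double sum over partitions of `σ` and root blocks of `τ` comes from the bilinear
    -- operation that prepends a tree to the first tensor factor.
    have := bilinear_sum_sum (LinearMap.rTensorHom (R := ℝ) (OF n ⊗[ℝ] TS n) ∘ₗ cat ∘ₗ letter)
      (partitions σ) (covered τ) (fun p => (p.1.map w).prod • δ p.2)
      (fun k => (δ k.atRoot) ⊗ₜ[ℝ]
        ((k.extracted.map w).prod • shuffleAllL k.above ⊗ₜ[ℝ] (δ k.block)))
    simp only [LinearMap.comp_apply, LinearMap.coe_rTensorHom] at this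
    rw [this]
    refine congrArg List.sum (List.map_congr_left fun p _ => ?_)
    rw [List.map_map]
    refine congrArg List.sum (List.map_congr_left fun k _ => ?_)
    rw [Function.comp_apply, List.map_append, List.prod_append, map_smul, letter_single, map_smul,
      LinearMap.rTensor_tmul, LinearMap.smul_apply, cat_single, TensorProduct.smul_tmul, smul_smul,
      List.singleton_append]
  · rw [coveredTensor, evalLeft_counit_sum, bilinear_sum_sum, ← TensorProduct.mk_apply,
      map_list_sum, sum_map_flatMap]
    simp [map_list_sum, List.map_map, Function.comp_def, shuffleAllL_append, shuffle_assoc,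
      smul_smul, mul_comm]

theorem weightedSum_append (L L' : List (List (PT n) × PT n)) :
    weightedSum w (L ++ L') = weightedSum w L + weightedSum w L' := by
  simp [weightedSum]

theorem weightedSum_uncovered_graft (σ τ : PT n) :
    weightedSum w (uncovered (PT.graft σ τ)) =
      graftL (contraction w (δ σ)) (weightedSum w (uncovered τ)) := by
  rw [contraction_single, weightedSum, uncovered, sum_map_flatMap, weightedSum, weightedSum,
    bilinear_sum_sum]
  simp [-Finsupp.smul_single, smul_smul, partitions, List.map_map,
    Function.comp_def, mul_comm]

theorem weightedSum_uncovered_bPlus (c : Fin (n + 1)) (ω : List (PT n)) :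
    weightedSum w (uncovered (PT.bPlus c ω)) = bPlusL c (letterwise (contraction w) (δ ω)) := by
  induction ω with
  | nil => simp [PT.bPlus, uncovered, weightedSum]
  | cons t ω ih =>
    change weightedSum w (uncovered (PT.graft t (PT.bPlus c ω))) = _
    rw [weightedSum_uncovered_graft, ih, letterwise_cons, bPlusL_cat_letter]

/-- The linear extension of a weight of trees. -/
noncomputable def weightL : TS n →ₗ[ℝ] ℝ := Finsupp.lift _ ℝ _ w

@[simp] theorem weightL_single (τ : PT n) : weightL w (δ τ) = w τ := by simp [weightL]

theorem weightedSum_covered (τ : PT n) :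
    weightedSum w ((covered τ).flatMap RootBlock.contract) =
      bPlusL 0 (evalRight (weightL w) (shuffleLeft _ (coveredTensor w τ))) := by
  rw [weightedSum, sum_map_flatMap, shuffleLeft_coveredTensor, map_list_sum, map_list_sum,
    List.map_map, List.map_map]
  congr 1
  refine List.map_congr_left fun k _ => ?_
  simp only [RootBlock.contract, List.map_map, Function.comp_def, map_smul, evalRight_tmul,
    weightL_single, shuffleAllL]
  rw [map_ofList]
  induction shuffleAll (k.atRoot :: k.above) with
  | nil => simp
  | cons u L ih =>
    simp only [List.map_cons, List.sum_cons] at ih ⊢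
    rw [ih]
    simp only [smul_add, smul_smul, List.prod_cons, mul_comm, bPlusL_single]

/-- Letterwise maps preserve the length of words, so nonempty words never produce the empty one. -/
theorem counit_comp_letterwise (A : TS n →ₗ[ℝ] TS n) : counit ∘ₗ letterwise A = counit := by
  refine linearMap_ext_basis fun ω => ?_
  cases ω with
  | nil => simp
  | cons t ω =>
    rw [LinearMap.comp_apply, letterwise_cons, counit_cat_letter_left, counit_single (by simp)]

theorem shuffleGraft_rTensor_letterwise (A : TS n →ₗ[ℝ] TS n) (x y : OF n ⊗[ℝ] TS n) :
    shuffleGraft (LinearMap.rTensor _ (letterwise A) x) (LinearMap.rTensor _ (letterwise A) y) =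
      LinearMap.rTensor _ (letterwise A) (shuffleGraft x y) := by
  induction x with
  | zero => simp
  | add a b ha hb => simp only [map_add, LinearMap.add_apply, ha, hb]
  | tmul x₁ x₂ =>
    induction y with
    | zero => simp
    | add a b ha hb => simp only [map_add, ha, hb]
    | tmul y₁ y₂ => simp [letterwise_shuffle]

theorem shuffleLeft_letterwise (A : TS n →ₗ[ℝ] TS n) (z : OF n ⊗[ℝ] (OF n ⊗[ℝ] TS n)) :
    shuffleLeft _ (LinearMap.rTensor _ (letterwise A)
      (LinearMap.lTensor _ (LinearMap.rTensor _ (letterwise A)) z)) =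
      LinearMap.rTensor _ (letterwise A) (shuffleLeft _ z) := by
  induction z with
  | zero => simp
  | add x y hx hy => simp only [map_add, hx, hy]
  | tmul x z =>
    induction z with
    | zero => simp
    | add x y hx hy => simp only [TensorProduct.tmul_add, map_add, hx, hy]
    | tmul y v => simp [letterwise_shuffle]

/-- A partition that covers the root amounts to a left admissible cut, whose trunk is the root
block, together with a partition of every pruned tree. Both sides satisfy the same recursion in
`graft`. -/
theorem coveredTensor_eq (τ : PT n) :
    coveredTensor w τ = LinearMap.rTensor _ (letterwise (contraction w))
      (LinearMap.lTensor _ (LinearMap.rTensor _ (letterwise (contraction w)))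
        (cutTensor τ)) := by
  induction τ with
  | vertex c => simp
  | graft σ τ ihσ ihτ =>
    rw [coveredTensor_graft, ihσ, ihτ, shuffleLeft_letterwise, evalLeft_rTensor,
      counit_comp_letterwise, evalLeft_lTensor, shuffleGraft_rTensor_letterwise, cutTensor_graft,
      cutCoaction_single, rootUncut, map_add, map_add]
    congr 1
    · induction cutTensor τ with
      | zero => simp
      | add x y hx hy => simp only [map_add, hx, hy]
      | tmul x z => simp [letterwise_cat, letterwise_cons]
    · simp

theorem contraction_bPlusL (c : Fin (n + 1)) (x : OF n) :
    contraction w (bPlusL c x) = bPlusL c (letterwise (contraction w) x) +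
      bPlusL 0 (letterwise (contraction w) (rightAction (weightL w ∘ₗ bPlusL c) x)) := by
  refine linearMap_apply_eq_of_basis (f := contraction w ∘ₗ bPlusL c)
    (g := bPlusL c ∘ₗ letterwise (contraction w) +
      bPlusL 0 ∘ₗ letterwise (contraction w) ∘ₗ rightAction (weightL w ∘ₗ bPlusL c))
    (fun ω => ?_) x
  simp only [LinearMap.comp_apply, LinearMap.add_apply]
  rw [bPlusL_single, contraction_single, partitions, weightedSum_append, weightedSum_covered,
    weightedSum_uncovered_bPlus, coveredTensor_eq, shuffleLeft_letterwise, evalRight_rTensor,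
    ← cutCoaction_single, ← bPlusL_single, cutCoaction_bPlusL, evalRight_lTensor]
  rfl

variable {w}

theorem contraction_bPlusL_zero (hw : ∀ ω, w (PT.bPlus 0 ω) = 0) (x : OF n) :
    contraction w (bPlusL 0 x) = bPlusL 0 (letterwise (contraction w) x) := by
  have h : weightL w ∘ₗ bPlusL 0 = 0 := linearMap_ext_basis fun ω => by simp [hw]
  have h2 : rightAction (0 : OF n →ₗ[ℝ] ℝ) = 0 := by
    simp [rightAction, evalRight]
  rw [contraction_bPlusL, h, h2]
  simp

end

/-! ## Transport to the model space -/

/-- The linear isomorphism `φ`. -/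
noncomputable def phiL : TS n ≃ₗ[ℝ] PBSpace n := Finsupp.domLCongr phi

@[simp] theorem phiL_single (τ : PT n) : phiL (δ τ) = δ (phi τ) := by simp [phiL]

@[simp] theorem bPlusPhiL_single (ω : List (PT n)) : bPlusPhiL (δ ω) = δ (bPlusPhi ω) := by
  simp [bPlusPhiL]

theorem bPlusPhi_val (ω : List (PT n)) : (bPlusPhi ω).1 = phi (PT.bPlus 0 ω) := bPlusE_map_phi ω

theorem incl_bPlusPhiL (x : OF n) : incl (bPlusPhiL x) = phiL (bPlusL 0 x) :=
  linearMap_apply_eq_of_basis (f := incl ∘ₗ bPlusPhiL.toLinearMap)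
    (g := phiL.toLinearMap ∘ₗ bPlusL 0) (fun ω => by simp [incl, bPlusPhi_val]) x

theorem proj_incl (x : PBPlusSpace n) : proj (incl x) = x :=
  linearMap_apply_eq_of_basis (f := proj ∘ₗ incl) (g := LinearMap.id)
    (fun τ => by simp [incl, proj, τ.2]) x

theorem bMinus_bPlusPhiL_letter (a : TS n) : bMinus (incl (bPlusPhiL (letter a))) = phiL a := by
  refine linearMap_apply_eq_of_basis
    (f := bMinus ∘ₗ incl ∘ₗ bPlusPhiL.toLinearMap ∘ₗ letter) (g := phiL.toLinearMap)
    (fun τ => ?_) a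
  simp [incl, bMinus, bPlusPhi, bPlusE, pointPB]

theorem eq_bPlus_of_noNoiseAtRoot {τ : PT n} (h : (phi τ).1.NoNoiseAtRoot) :
    τ = PT.bPlus 0 τ.branches := by
  have h1 := root_phiInv _ h
  have h2 : phiInv (phi τ).1 = τ := phiInv_phiFun τ
  rw [h2] at h1
  have h3 := PT.bPlus_root_branches τ
  rw [h1] at h3
  exact h3.symm

theorem bPlusPhi_symm_phi {τ : PT n} (h : (phi τ).1.NoNoiseAtRoot) :
    bPlusPhi.symm ⟨phi τ, h⟩ = τ.branches := by
  change (phi.symm (phi τ)).branches = _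
  rw [Equiv.symm_apply_apply]

/-- For a decorated edge at the root, the coproduct of the one-letter word `τ` is the coaction of
`τ` plus `τ ⊗ 1`. The subtraction in `Δ⁺` removes the second term and `B₋` undoes the passage from
trees to letters in the first. -/
theorem deltaPlus_phiL (a : TS n) :
    deltaPlus (phiL a) =
      TensorProduct.map bPlusPhiL.toLinearMap phiL.toLinearMap (cutCoaction a) := by
  refine linearMap_apply_eq_of_basis (f := deltaPlus ∘ₗ phiL.toLinearMap)
    (g := TensorProduct.map bPlusPhiL.toLinearMap phiL.toLinearMap ∘ₗ cutCoaction)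
    (fun τ => ?_) a
  simp only [LinearMap.comp_apply, LinearEquiv.coe_coe, phiL_single]
  rw [deltaPlus]
  simp only [Finsupp.lift_apply, zero_smul, Finsupp.sum_single_index, one_smul]
  split_ifs with h
  · rw [bPlusPhi_symm_phi h, deltaPlusRooted, LinearMap.comp_apply]
    conv_rhs => rw [eq_bPlus_of_noNoiseAtRoot h, ← bPlusL_single, cutCoaction_bPlusL]
    induction mkw (δ τ.branches) with
    | zero => simp
    | add x y hx hy => simp only [map_add, hx, hy]
    | tmul x y => simp [incl_bPlusPhiL]
  · have h1 := mkw_concat [] τ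
    rw [List.nil_append, mkw_one, shuffleCat_one_left] at h1
    rw [Equiv.symm_apply_apply, deltaPlusRooted, LinearMap.comp_apply, h1, map_add,
      TensorProduct.map_tmul, LinearMap.comp_apply, LinearEquiv.coe_coe, bPlusPhiL_single,
      bPlusPhiL_single]
    have h2 : incl (δ (bPlusPhi ([] : List (PT n)))) = δ pointPB := by
      simp [incl, bPlusPhi, bPlusE]
    have h3 : ∀ x y : PBPlusSpace n ⊗[ℝ] PBSpace n, x + y - y = x := fun x y =>
      @add_sub_cancel_right _ (TensorProduct.addCommGroup).toAddGroup x y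
    rw [h2]
    refine (congrArg _ (h3 _ _)).trans ?_
    rw [letterCoaction, LinearMap.comp_apply]
    induction cutCoaction (δ τ) with
    | zero => simp
    | add x y hx hy => simp only [map_add, hx, hy]
    | tmul x y => simp [bMinus_bPlusPhiL_letter]

theorem gammaOp_phiL (g : PBPlusSpace n →ₗ[ℝ] ℝ) (a : TS n) :
    gammaOp g (phiL a) = phiL (treeAction (g ∘ₗ bPlusPhiL.toLinearMap) a) := by
  rw [gammaOp, LinearMap.comp_apply, LinearMap.comp_apply, deltaPlus_phiL, treeAction,
    LinearMap.comp_apply]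
  induction cutCoaction a with
  | zero => simp
  | add x y hx hy => simp only [map_add, hx, hy]
  | tmul x y => simp

theorem treeProd_bPlusPhiL (x y : OF n) :
    treeProd (bPlusPhiL x) (bPlusPhiL y) = bPlusPhiL (shuffle x y) := by
  induction x using basis_induction with
  | zero => simp
  | add a b ha hb => simp [ha, hb]
  | smul r a ha => simp [ha]
  | basis u =>
    induction y using basis_induction with
    | zero => simp
    | add a b ha hb => simp only [map_add, ha, hb]
    | smul r a ha => simp only [map_smul, ha]
    | basis v =>
      rw [shuffle_single, bPlusPhiL_single, bPlusPhiL_single, ← LinearEquiv.coe_coe, map_ofList]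
      simp [treeProd]

theorem IsShuffleCharacter.isCharacter {g : PBPlusSpace n →ₗ[ℝ] ℝ}
    (h : IsShuffleCharacter (g ∘ₗ bPlusPhiL.toLinearMap)) : IsCharacter g := by
  refine ⟨by simpa using h.1, fun x y => ?_⟩
  have := h.2 (bPlusPhiL.symm x) (bPlusPhiL.symm y)
  simpa [← treeProd_bPlusPhiL] using this

section

variable {α : Fin n → ℝ}

/-- The weight of a block in the renormalisation map of `ℓ`. -/
noncomputable def blockWeight (ℓ : SPBNeg α →ₐ[ℝ] ℝ) : PT n → ℝ := fun σ =>
  ℓ (phiProjNeg α (MvPolynomial.X σ))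

theorem renorm_phiL (ℓ : SPBNeg α →ₐ[ℝ] ℝ) (a : TS n) :
    renorm ℓ (phiL a) = phiL (contraction (blockWeight ℓ) a) := by
  refine linearMap_apply_eq_of_basis (f := renorm ℓ ∘ₗ phiL.toLinearMap)
    (g := phiL.toLinearMap ∘ₗ contraction (blockWeight ℓ)) (fun τ => ?_) a
  simp only [LinearMap.comp_apply, LinearEquiv.coe_coe, phiL_single, contraction_single,
    weightedSum]
  rw [renorm, deltaMinus]
  simp [-Finsupp.smul_single, timeCotranslation, map_list_sum,
    map_list_prod, List.map_map, Function.comp_def]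
  rfl

/-- Such a tree has no decorated edge at its root after `φ`, so its degree is zero or positive and
`π⁻` kills it. -/
theorem blockWeight_bPlus_zero (hα : ∀ i, 0 < α i) (ℓ : SPBNeg α →ₐ[ℝ] ℝ) (ω : List (PT n)) :
    blockWeight ℓ (PT.bPlus 0 ω) = 0 := by
  have h : ¬ deg α (phi (PT.bPlus 0 ω)) < 0 := by
    have h1 := bPlusE_noNoise (ω.map phi)
    have h2 := degree_pos_of_noNoise α hα _ (bPlusE (ω.map phi)).2
    rcases h2.2 h1 with h3 | h3
    · rw [bPlusE_map_phi] at h3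
      rw [deg, h3]
      simp [ETree.degree]
    · rw [bPlusE_map_phi] at h3
      exact not_lt.mpr h3.le
  simp [blockWeight, phiProjNeg, h]

end

/-! ## Continuous functions of polynomial growth as tempered distributions -/

section

open MeasureTheory

/-- Continuous functions of polynomial growth. -/
def PolyGrowth (f : ℝ → ℝ) : Prop :=
  Continuous f ∧ ∃ (C : ℝ) (N : ℕ), ∀ t, |f t| ≤ C * (1 + t ^ 2) ^ N

theorem PolyGrowth.const (c : ℝ) : PolyGrowth fun _ => c :=
  ⟨continuous_const, |c|, 0, fun t => by simp⟩

theorem PolyGrowth.add {f g : ℝ → ℝ} (hf : PolyGrowth f) (hg : PolyGrowth g) :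
    PolyGrowth fun t => f t + g t := by
  obtain ⟨hf, C, N, hC⟩ := hf
  obtain ⟨hg, D, M, hD⟩ := hg
  refine ⟨hf.add hg, |C| + |D|, N + M, fun t => ?_⟩
  have h1 : (1 : ℝ) ≤ 1 + t ^ 2 := by nlinarith [sq_nonneg t]
  have h2 : C * (1 + t ^ 2) ^ N ≤ |C| * (1 + t ^ 2) ^ (N + M) := by
    gcongr
    · exact le_abs_self C
    · omega
  have h3 : D * (1 + t ^ 2) ^ M ≤ |D| * (1 + t ^ 2) ^ (N + M) := by
    gcongr
    · exact le_abs_self D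
    · omega
  calc |f t + g t| ≤ |f t| + |g t| := abs_add_le _ _
    _ ≤ (|C| + |D|) * (1 + t ^ 2) ^ (N + M) := by
      rw [add_mul]; linarith [hC t, hD t]

theorem PolyGrowth.const_mul {f : ℝ → ℝ} (hf : PolyGrowth f) (r : ℝ) :
    PolyGrowth fun t => r * f t := by
  obtain ⟨hf, C, N, hC⟩ := hf
  refine ⟨continuous_const.mul hf, |r| * C, N, fun t => ?_⟩
  rw [abs_mul, mul_assoc]
  gcongr
  exact hC t

/-- Splits `f` into a bounded continuous function times a power of `1 + t²`; the latter can be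
absorbed by Schwartz functions. -/
theorem PolyGrowth.exists_weight {f : ℝ → ℝ} (hf : PolyGrowth f) :
    ∃ (p : ℝ → ℂ) (q : ℝ → ℂ) (C : ℝ), p.HasTemperateGrowth ∧ Continuous q ∧
      (∀ t, ‖q t‖ ≤ C) ∧ ∀ t, (f t : ℂ) = q t * p t := by
  obtain ⟨hf, C, N, hC⟩ := hf
  have h1 : ∀ t : ℝ, (0 : ℝ) < (1 + t ^ 2) ^ N := fun t => by positivity
  refine ⟨fun t => (((1 + t ^ 2) ^ N : ℝ) : ℂ), fun t => ((f t / (1 + t ^ 2) ^ N : ℝ) : ℂ), C,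
    ?_, ?_, fun t => ?_, fun t => ?_⟩
  · have h : (fun t : ℝ => (1 + t ^ 2) ^ N).HasTemperateGrowth := by fun_prop
    exact Function.HasTemperateGrowth.comp Function.Complex.hasTemperateGrowth_ofReal h
  · exact Complex.continuous_ofReal.comp
      (hf.div (by fun_prop) fun t => (h1 t).ne')
  · rw [Complex.norm_real, Real.norm_eq_abs, abs_div, abs_of_pos (h1 t), div_le_iff₀ (h1 t)]
    exact hC t
  · rw [← Complex.ofReal_mul, div_mul_cancel₀ _ (h1 t).ne']

theorem PolyGrowth.integrable {f : ℝ → ℝ} (hf : PolyGrowth f) (ψ : 𝓢(ℝ, ℂ)) :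
    Integrable fun t => (f t : ℂ) * ψ t := by
  obtain ⟨p, q, C, hp, hq, hC, h⟩ := hf.exists_weight
  have h1 := (SchwartzMap.smulLeftCLM ℂ p ψ).integrable (μ := volume)
  have h2 := h1.bdd_mul (c := C) hq.aestronglyMeasurable (Filter.Eventually.of_forall hC)
  refine h2.congr (Filter.Eventually.of_forall fun t => ?_)
  simp [h, hp, mul_assoc]

theorem PolyGrowth.tempered {f : ℝ → ℝ} (hf : PolyGrowth f) :
    ∃ u : 𝓢'(ℝ, ℂ), ∀ ψ : 𝓢(ℝ, ℂ), u ψ = functional f ψ := by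
  obtain ⟨p, q, C, hp, hq, hC, h⟩ := hf.exists_weight
  have hm : MemLp q ⊤ (volume : Measure ℝ) :=
    memLp_top_of_bound hq.aestronglyMeasurable C (Filter.Eventually.of_forall hC)
  refine ⟨TemperedDistribution.smulLeftCLM ℂ p (Lp.toTemperedDistribution (hm.toLp q)),
    fun ψ => ?_⟩
  rw [TemperedDistribution.smulLeftCLM_apply_apply, Lp.toTemperedDistribution_apply, functional]
  refine integral_congr_ae ?_
  filter_upwards [hm.coeFn_toLp] with t ht
  rw [ht, SchwartzMap.smulLeftCLM_apply_apply hp, h]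
  simp only [smul_eq_mul]
  ring

theorem functional_add {f g : ℝ → ℝ} (hf : PolyGrowth f) (hg : PolyGrowth g) :
    functional (fun t => f t + g t) = functional f + functional g := by
  funext ψ
  rw [Pi.add_apply, functional, functional, functional,
    ← integral_add (hf.integrable ψ) (hg.integrable ψ)]
  refine integral_congr_ae (Filter.Eventually.of_forall fun t => ?_)
  simp [add_mul]

theorem functional_const_mul (r : ℝ) (f : ℝ → ℝ) :
    functional (fun t => r * f t) = r • functional f := by
  funext ψ
  rw [Pi.smul_apply, functional, functional, Complex.real_smul, ← integral_const_mul]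
  refine integral_congr_ae (Filter.Eventually.of_forall fun t => ?_)
  simp [mul_assoc]

/-- Integration by parts on the line; integrability of the three products makes the boundary terms
vanish. -/
theorem distDeriv_functional {F f : ℝ → ℝ} (hF : PolyGrowth F) (hf : PolyGrowth f)
    (h : ∀ t, HasDerivAt F (f t) t) : distDeriv (functional F) = functional f := by
  funext ψ
  rw [distDeriv, functional, functional]
  have h1 := integral_mul_deriv_eq_deriv_mul_of_integrable (A := ℂ)
    (u := fun t => (F t : ℂ)) (u' := fun t => (f t : ℂ)) (v := fun t => ψ t)
    (v' := fun t => SchwartzMap.derivCLM ℂ ℂ ψ t)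
    (fun t _ => (h t).ofReal_comp) (fun t _ => ψ.hasDerivAt t)
    (hF.integrable (SchwartzMap.derivCLM ℂ ℂ ψ)) (hf.integrable ψ) (hF.integrable ψ)
  rw [h1, neg_neg]

theorem distDeriv_functional_tempered {F : ℝ → ℝ} (hF : PolyGrowth F) :
    ∃ u : 𝓢'(ℝ, ℂ), ∀ ψ : 𝓢(ℝ, ℂ), u ψ = distDeriv (functional F) ψ := by
  obtain ⟨u, hu⟩ := hF.tempered
  refine ⟨TemperedDistribution.derivCLM ℂ u, fun ψ => ?_⟩
  rw [TemperedDistribution.derivCLM_apply_apply, map_neg, hu]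
  rfl

/-- The distributional derivative as a linear map. -/
noncomputable def distDerivL : (𝓢(ℝ, ℂ) → ℂ) →ₗ[ℝ] (𝓢(ℝ, ℂ) → ℂ) where
  toFun := distDeriv
  map_add' u v := by funext ψ; simp [distDeriv, add_comm]
  map_smul' r u := by funext ψ; simp [distDeriv]

end

/-! ## Regularity of rough paths -/

section

variable {γ : ℝ} {X : ℝ → ℝ → OF n →ₗ[ℝ] ℝ} (hX : IsRoughPath γ X)

include hX

theorem IsRoughPath.isShuffleCharacter (s t : ℝ) : IsShuffleCharacter (X s t) :=
  ⟨hX.unit s t, hX.mul s t⟩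

theorem IsRoughPath.comp_forestAction (s u t : ℝ) :
    X u t ∘ₗ forestAction (X s u) = X s t := by
  rw [← conv_eq_comp, hX.chen]

theorem IsRoughPath.self (s : ℝ) : X s s = counit :=
  (hX.isShuffleCharacter s s).eq_counit_of_idempotent (hX.chen s s s)

theorem IsRoughPath.tendsto_self (hγ : 0 < γ) (s : ℝ) (x : OF n) :
    Filter.Tendsto (fun t => X s t x) (nhds s) (nhds (X s s x)) := by
  induction x using basis_induction with
  | zero => simp
  | add x y hx hy => simp only [map_add]; exact hx.add hy
  | smul r x hx => simp only [map_smul, smul_eq_mul]; exact hx.const_mul r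
  | basis ω =>
    by_cases hω : ω = []
    · subst hω
      simp only [hX.unit]
      exact tendsto_const_nhds
    · have hs : 0 < forestSize ω := Nat.pos_of_ne_zero fun h => hω (forestSize_eq_zero h)
      have hr : 0 < γ * (forestSize ω : ℝ) := mul_pos hγ (by exact_mod_cast hs)
      obtain ⟨C, N, h⟩ := hX.holder ω
      have h0 : X s s (δ ω) = 0 := by rw [hX.self, counit_single hω]
      rw [h0]
      have hlim : Filter.Tendsto (fun t : ℝ =>
          C * (1 + |s| + |t|) ^ N * |t - s| ^ (γ * (forestSize ω : ℝ))) (nhds s) (nhds 0) := by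
        have hc : Continuous fun t : ℝ =>
            C * (1 + |s| + |t|) ^ N * |t - s| ^ (γ * (forestSize ω : ℝ)) :=
          (by fun_prop : Continuous fun t : ℝ => C * (1 + |s| + |t|) ^ N).mul
            ((by fun_prop : Continuous fun t : ℝ => |t - s|).rpow_const fun _ => Or.inr hr.le)
        have := hc.tendsto s
        simpa [Real.zero_rpow hr.ne'] using this
      refine squeeze_zero_norm (fun t => ?_) hlim
      by_cases hst : s = t
      · subst hst
        rw [h0]
        simp [Real.zero_rpow hr.ne']
      · exact h s t hst

/-- The Hölder bound gives continuity at the base point only; Chen's relation moves the base point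
to the point considered. -/
theorem IsRoughPath.continuous (hγ : 0 < γ) (s : ℝ) (x : OF n) :
    Continuous fun t => X s t x := by
  refine continuous_iff_continuousAt.mpr fun t₀ => ?_
  have h : ∀ t, X s t x = X t₀ t (forestAction (X s t₀) x) := fun t => by
    rw [← hX.comp_forestAction s t₀ t]; rfl
  simp only [ContinuousAt, h]
  exact hX.tendsto_self hγ t₀ _

theorem IsRoughPath.polyGrowth (hγ : 0 < γ) (s : ℝ) (x : OF n) :
    PolyGrowth fun t => X s t x := by
  induction x using basis_induction with
  | zero => simpa using PolyGrowth.const 0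
  | add x y hx hy => simpa using hx.add hy
  | smul r x hx => simpa using hx.const_mul r
  | basis ω =>
    refine ⟨hX.continuous hγ s _, ?_⟩
    obtain ⟨C, N, h⟩ := hX.holder ω
    set r := γ * (forestSize ω : ℝ) with hr
    have hr0 : 0 ≤ r := mul_nonneg hγ.le (Nat.cast_nonneg _)
    set K := ⌈r⌉₊
    -- The first summand serves `t ≠ s`, using `1 + |s| + |t| ≤ 2 (1 + |s|) (1 + t²)` and the
    -- rounding of the exponent `r` up to `K`. The second serves `t = s`, which the Hölder bound
    -- omits.
    refine ⟨|C| * (2 * (1 + |s|)) ^ (N + K) + |X s s (δ ω)|, N + K, fun t => ?_⟩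
    have h1 : (1 : ℝ) ≤ 1 + t ^ 2 := by nlinarith [sq_nonneg t]
    have h2 : (1 : ℝ) ≤ (1 + t ^ 2) ^ (N + K) := one_le_pow₀ h1
    by_cases hst : s = t
    · subst hst
      have : 0 ≤ |C| * (2 * (1 + |s|)) ^ (N + K) := by positivity
      nlinarith [abs_nonneg (X s s (δ ω))]
    · have h3 : 1 + |s| + |t| ≤ 2 * (1 + |s|) * (1 + t ^ 2) := by
        have := abs_nonneg s
        have h5 : |t| ≤ 1 + t ^ 2 := by
          rw [← sq_abs t]; nlinarith [sq_nonneg (|t| - 1), abs_nonneg t]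
        nlinarith [sq_nonneg t]
      have h4 : |t - s| ^ r ≤ (1 + |s| + |t|) ^ K := by
        have h5 : |t - s| ≤ 1 + |s| + |t| := by
          have := abs_sub t s; linarith
        have h6 : (1 : ℝ) ≤ 1 + |s| + |t| := by
          linarith [abs_nonneg s, abs_nonneg t]
        calc |t - s| ^ r ≤ (1 + |s| + |t|) ^ r := Real.rpow_le_rpow (abs_nonneg _) h5 hr0
          _ ≤ (1 + |s| + |t|) ^ (K : ℝ) := Real.rpow_le_rpow_of_exponent_le h6 (Nat.le_ceil r)
          _ = (1 + |s| + |t|) ^ K := Real.rpow_natCast _ _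
      calc |X s t (δ ω)| ≤ C * (1 + |s| + |t|) ^ N * |t - s| ^ r := h s t hst
        _ ≤ |C| * (1 + |s| + |t|) ^ N * (1 + |s| + |t|) ^ K := by
          gcongr
          exact le_abs_self C
        _ = |C| * (1 + |s| + |t|) ^ (N + K) := by rw [mul_assoc, ← pow_add]
        _ ≤ |C| * (2 * (1 + |s|) * (1 + t ^ 2)) ^ (N + K) := by gcongr
        _ = |C| * (2 * (1 + |s|)) ^ (N + K) * (1 + t ^ 2) ^ (N + K) := by
          rw [mul_pow (2 * (1 + |s|))]; ring
        _ ≤ _ := by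
          rw [add_mul]
          have : 0 ≤ |X s s (δ ω)| * (1 + t ^ 2) ^ (N + K) := by positivity
          linarith

/-- Integration against the components of a rough path. -/
noncomputable def IsRoughPath.toFunctional (hγ : 0 < γ) (s : ℝ) :
    OF n →ₗ[ℝ] (𝓢(ℝ, ℂ) → ℂ) where
  toFun x := functional fun t => X s t x
  map_add' x y := by
    simp only [map_add]
    exact functional_add (hX.polyGrowth hγ s x) (hX.polyGrowth hγ s y)
  map_smul' r x := by
    simp only [map_smul, smul_eq_mul, RingHom.id_apply]
    exact functional_const_mul r _

theorem IsRoughPath.toFunctional_apply (hγ : 0 < γ) (s : ℝ) (x : OF n) :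
    hX.toFunctional hγ s x = functional fun t => X s t x := rfl

/-- One formula covers both clauses of `Π`: without a decorated edge at the root, `B₊^0` is
integration, so the fundamental theorem of calculus gives back the function. -/
theorem IsRoughPath.modelPi_phiL (hγ : 0 < γ)
    (hint : ∀ (ω : List (PT n)) (s t : ℝ),
      X s t (δ [PT.bPlus 0 ω]) = ∫ u in s..t, X s u (δ ω)) (s : ℝ) (a : TS n) :
    modelPi X s (phiL a) = distDeriv (functional fun t => X s t (letter a)) := by
  refine linearMap_apply_eq_of_basis (f := modelPi X s ∘ₗ phiL.toLinearMap)
    (g := distDerivL ∘ₗ hX.toFunctional hγ s ∘ₗ letter) (fun τ => ?_) a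
  simp only [LinearMap.comp_apply, LinearEquiv.coe_coe, phiL_single, letter_single,
    IsRoughPath.toFunctional_apply]
  change _ = distDeriv _
  rw [modelPi]
  simp only [Finsupp.lift_apply, zero_smul, Finsupp.sum_single_index, one_smul]
  split_ifs with h
  · rw [bPlusPhi_symm_phi h]
    refine (distDeriv_functional (hX.polyGrowth hγ s _) (hX.polyGrowth hγ s _) fun t => ?_).symm
    have h1 : (fun t => X s t (δ [τ])) = fun t => ∫ u in s..t, X s u (δ τ.branches) := by
      funext t
      rw [← hint, ← eq_bPlus_of_noNoiseAtRoot h]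
    rw [h1]
    have hc := hX.continuous hγ s (δ τ.branches)
    exact intervalIntegral.integral_hasDerivAt_right (hc.intervalIntegrable _ _)
      (hc.stronglyMeasurableAtFilter _ _) hc.continuousAt
  · rw [Equiv.symm_apply_apply]

/-- By Chen's relation the two primitives differ by the constant `X y x (letter b)`, coming from the
term in which the whole tree is cut off. -/
theorem IsRoughPath.distDeriv_treeAction (hγ : 0 < γ) (x y : ℝ) (b : TS n) :
    distDeriv (functional fun t => X x t (letter (treeAction (X y x) b))) =
      distDeriv (functional fun t => X y t (letter b)) := by
  have hg := hX.isShuffleCharacter y x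
  have h1 : (fun t => X y t (letter b)) = fun t =>
      X x t (letter (treeAction (X y x) b)) + X y x (letter b) := by
    funext t
    have h2 := hg.forestAction_cat_letter (δ []) b
    rw [cat_one_left, hg.forestAction_one, cat_one_left] at h2
    rw [← hX.comp_forestAction y x t, LinearMap.comp_apply, h2, map_add, map_smul, hX.unit,
      smul_eq_mul, mul_one]
  have h3 : distDerivL (functional fun _ => X y x (letter b)) = 0 := by
    refine (distDeriv_functional (PolyGrowth.const _) (PolyGrowth.const 0)
      fun t => hasDerivAt_const t _).trans ?_
    funext ψ
    simp [functional]
  rw [h1, functional_add (hX.polyGrowth hγ x _) (PolyGrowth.const _)]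
  change _ = distDerivL _
  rw [map_add, h3, add_zero]
  rfl

end

/-! ## Finiteness of the homogeneous components -/

theorem finite_size_le (N : ℕ) : {τ : PT n | τ.size ≤ N}.Finite := by
  induction N with
  | zero =>
    refine Set.Finite.subset Set.finite_empty fun τ hτ => ?_
    have := τ.size_pos
    simp only [Set.mem_ofPred_eq] at hτ
    omega
  | succ N ih =>
    refine ((Set.finite_range PT.vertex).union (ih.image2 PT.graft ih)).subset fun τ hτ => ?_
    cases τ with
    | vertex c => exact Or.inl ⟨c, rfl⟩
    | graft σ τ =>
      have h1 := σ.size_pos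
      have h2 := τ.size_pos
      simp only [Set.mem_ofPred_eq, PT.size] at hτ
      exact Or.inr ⟨σ, by simp only [Set.mem_ofPred_eq]; omega, τ,
        by simp only [Set.mem_ofPred_eq]; omega, rfl⟩

/-- Charge each undecorated edge to its upper vertex and each decorated edge to the vertex it
replaces. A vertex then contributes `1` or `α i`, except that the root, having no edge below it,
lacks `1`. -/
theorem le_degree_phiFun (α : Fin n → ℝ) {m : ℝ} (hm : m ≤ 1) (hα : ∀ i, m ≤ α i) (τ : PT n) :
    m * τ.size - 1 ≤ (phiFun τ).degree α := by
  induction τ with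
  | vertex c =>
    by_cases h : c = 0
    · simp only [phiFun, h, if_true, ETree.degree, PT.size]
      push_cast; linarith
    · obtain ⟨i, rfl⟩ := Fin.exists_succ_eq.mpr h
      have := hα i
      simp only [phiFun, h, if_false, ETree.degree, PT.size, Fin.cases_succ]
      push_cast; linarith
  | graft σ τ ihσ ihτ =>
    simp only [phiFun, ETree.degree, PT.size, Fin.cases_zero]
    push_cast; linarith

theorem finite_deg_eq (α : Fin n → ℝ) (hα : ∀ i, 0 < α i) (a : ℝ) :
    {τ : PB n | deg α τ = a}.Finite := by
  obtain ⟨m, hm0, hm1, hm⟩ : ∃ m : ℝ, 0 < m ∧ m ≤ 1 ∧ ∀ i, m ≤ α i := by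
    -- The extra point of `Option` carries the value `1`, so the minimum is at most `1` and exists
    -- even when `n = 0`.
    obtain ⟨j, hj⟩ := Finite.exists_min (fun o : Option (Fin n) => o.elim 1 α)
    refine ⟨j.elim 1 α, ?_, hj none, fun i => hj (some i)⟩
    cases j with
    | none => exact one_pos
    | some i => exact hα i
  refine ((finite_size_le (n := n) ⌊(a + 1) / m⌋₊).image phi).subset fun τ hτ => ?_
  refine ⟨phi.symm τ, ?_, phi.apply_symm_apply τ⟩
  have h1 := le_degree_phiFun α hm1 hm (phi.symm τ)
  have h2 : (phiFun (phi.symm τ)).degree α = a :=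
    (congrArg (deg α) (phi.apply_symm_apply τ)).trans hτ
  rw [h2] at h1
  refine Nat.le_floor ?_
  rw [le_div_iff₀ hm0]
  linarith

theorem exists_bound_of_finite {B : Type} {L : (B →₀ ℝ) →ₗ[ℝ] (𝓢(ℝ, ℂ) → ℂ)} {p : B → Prop}
    (hp : {b | p b}.Finite) (ψ : 𝓢(ℝ, ℂ)) : ∃ C : ℝ, ∀ v : B →₀ ℝ, (∀ b ∈ v.support, p b) →
      ‖L v ψ‖ ≤ C * ∑ b ∈ v.support, |v b| := by
  refine ⟨∑ b ∈ hp.toFinset, ‖L (δ b) ψ‖, fun v hv => ?_⟩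
  have h1 : L v ψ = ∑ b ∈ v.support, v b • L (δ b) ψ := by
    conv_lhs => rw [← Finsupp.sum_single v, Finsupp.sum, map_sum, Finset.sum_apply]
    refine Finset.sum_congr rfl fun b _ => ?_
    rw [← Pi.smul_apply, ← map_smul, Finsupp.smul_single, smul_eq_mul, mul_one]
  rw [h1, Finset.mul_sum]
  refine (norm_sum_le _ _).trans (Finset.sum_le_sum fun b hb => ?_)
  rw [norm_smul, Real.norm_eq_abs, mul_comm]
  gcongr
  exact Finset.single_le_sum (f := fun b => ‖L (δ b) ψ‖) (fun _ _ => norm_nonneg _)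
    (hp.mem_toFinset.mpr (hv b hb))

/-! ## The renormalised model -/

section

variable {α : Fin n → ℝ} (hα : ∀ i, 0 < α i) (ℓ : SPBNeg α →ₐ[ℝ] ℝ)

include hα

theorem renorm_incl_bPlusPhiL (x : OF n) :
    renorm ℓ (incl (bPlusPhiL x)) =
      incl (bPlusPhiL (letterwise (contraction (blockWeight ℓ)) x)) := by
  rw [incl_bPlusPhiL, renorm_phiL, contraction_bPlusL_zero (blockWeight_bPlus_zero hα ℓ),
    incl_bPlusPhiL]

theorem gammaChar_renorm_comp_bPlusPhiL (X : ℝ → ℝ → OF n →ₗ[ℝ] ℝ) (s t : ℝ) :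
    (gammaChar X t s ∘ₗ proj ∘ₗ renorm ℓ ∘ₗ incl) ∘ₗ bPlusPhiL.toLinearMap =
      X t s ∘ₗ letterwise (contraction (blockWeight ℓ)) := by
  refine LinearMap.ext fun x => ?_
  simp [renorm_incl_bPlusPhiL hα, proj_incl, gammaChar]

theorem renormGamma_phiL (X : ℝ → ℝ → OF n →ₗ[ℝ] ℝ) (s t : ℝ) (a : TS n) :
    renormGamma X ℓ s t (phiL a) =
      phiL (treeAction (X t s ∘ₗ letterwise (contraction (blockWeight ℓ))) a) := by
  rw [renormGamma, gammaOp_phiL, gammaChar_renorm_comp_bPlusPhiL hα]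

end

end PlanarRP

open PlanarRP
theorem mainTheorem2 (n : ℕ) (α : Fin n → ℝ) (hα : ∀ i, 0 < α i)
    (γ : ℝ) (hγ : 0 < γ) (hγ1 : γ ≤ 1)
    (X : ℝ → ℝ → OF n →ₗ[ℝ] ℝ) (hX : IsRoughPath γ X)
    (htime : ∀ s t : ℝ, X s t (Finsupp.single [PT.vertex 0] 1) = t - s)
    (hint : ∀ (ω : List (PT n)) (s t : ℝ),
      X s t (Finsupp.single [PT.bPlus 0 ω] 1) = ∫ u in s..t, X s u (Finsupp.single ω 1))
    (ℓ : SPBNeg α →ₐ[ℝ] ℝ) :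
    (∀ x : PBPlusSpace n, ∃ y : PBPlusSpace n, renorm ℓ (incl x) = incl y) ∧
      IsModel (deg α) (structureGroup n) (renormPi X ℓ) (renormGamma X ℓ) := by
  have hA := contraction_bPlusL (blockWeight ℓ)
  refine ⟨fun x => ?_, ?_, ?_, ?_, ?_, ?_, ?_⟩
  · obtain ⟨y, rfl⟩ := bPlusPhiL.surjective x
    exact ⟨_, renorm_incl_bPlusPhiL hα ℓ y⟩
  · intro x y
    refine ⟨_, IsShuffleCharacter.isCharacter ?_, rfl⟩
    rw [gammaChar_renorm_comp_bPlusPhiL hα]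
    exact (hX.isShuffleCharacter y x).comp_letterwise _
  · intro x
    refine LinearMap.ext fun v => ?_
    obtain ⟨a, rfl⟩ := phiL.surjective v
    rw [renormGamma_phiL hα, hX.self, counit_comp_letterwise, treeAction_counit]
    rfl
  · intro x y z
    refine LinearMap.ext fun v => ?_
    obtain ⟨a, rfl⟩ := phiL.surjective v
    rw [LinearMap.comp_apply, renormGamma_phiL hα, renormGamma_phiL hα, renormGamma_phiL hα,
      ((hX.isShuffleCharacter z y).comp_letterwise _).treeAction_treeAction]
    congr 3
    refine LinearMap.ext fun w => ?_
    simp only [LinearMap.comp_apply]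
    -- The intertwining moves the letterwise contraction to the inside; the remaining outer factors
    -- combine by Chen's relation.
    rw [← forestAction_letterwise hA (hX.isShuffleCharacter z y), ← hX.comp_forestAction z y x,
      LinearMap.comp_apply]
  · intro x v
    obtain ⟨a, rfl⟩ := phiL.surjective v
    rw [renormPi, LinearMap.comp_apply, renorm_phiL, hX.modelPi_phiL hγ hint]
    exact distDeriv_functional_tempered (hX.polyGrowth hγ x _)
  · intro x a ψ
    exact exists_bound_of_finite (finite_deg_eq α hα a) ψ
  · intro x y
    refine LinearMap.ext fun v => ?_
    obtain ⟨a, rfl⟩ := phiL.surjective v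
    simp only [renormPi, LinearMap.comp_apply]
    -- Contraction after the renormalised recentring equals the original recentring after
    -- contraction, so the claim reduces to the unrenormalised one.
    rw [renormGamma_phiL hα, renorm_phiL, renorm_phiL, hX.modelPi_phiL hγ hint,
      hX.modelPi_phiL hγ hint, ← treeAction_comm hA (hX.isShuffleCharacter y x),
      hX.distDeriv_treeAction hγ]
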